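/- Call a linear space $\mathcal E$ of bounded real sequences with $\ell_1\subseteq\mathcal E\subseteq\ell_\infty$, complete in its own norm $\|\cdot\|_{\mathcal E}$, a symmetric sequence space if, whenever $x\in\mathcal E$, $y\in\ell_\infty$ and the decreasing rearrangements of $|x|,|y|$ satisfy $y^*\le x^*$, one has $y\in\mathcal E$ and $\|y\|_{\mathcal E}\le\|x\|_{\mathcal E}$. For a bounded operator $x$ on the complex Hilbert space $\ell_2$ let $s_n(x)=\inf\{\|xe\| : e \text{ an orthogonal projection},\ \operatorname{rank}(1-e)\le n\}$, $n\ge 0$, be its singular numbers. Let $\mathcal S_{\mathcal E}$ be the space of all $x\in B(\ell_2)$ with $(s_n(x))_n\in\mathcal E$, with $\|x\|=\|(s_n(x))_n\|_{\mathcal E}$, and let $\mathcal S_1=\mathcal S_{\ell_1}$ be the trace class. Both are ordered by their cones of positive semidefinite operators; for linear maps $T,S:\mathcal S_1\to\mathcal S_{\mathcal E}$ write $T\ge 0$ if $T$ maps positive operators to positive operators, and $T\le S$ if $S-T\ge 0$. A linear map $T:\mathcal S_1\to\mathcal S_{\mathcal E}$ is the Schur multiplier with symbol $\phi=(\phi_{ij})$,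 written $\mathbf S_\phi$, if $(Tx)_{ij}=\phi_{ij}x_{ij}$ for all $x\in\mathcal S_1$ and all $i,j$ (matrix entries with respect to the canonical basis of $\ell_2$). It is Dunford--Pettis if it maps weakly null sequences to norm null sequences. **Theorem.** Let $\mathcal E$ be a symmetric sequence space, and let $0\le \mathbf S_\phi\le \mathbf S_\psi$ be Schur multipliers from $\mathcal S_1$ to $\mathcal S_{\mathcal E}$. If $\mathbf S_\psi$ is Dunford--Pettis, then so is $\mathbf S_\phi$. -/

import Mathlib

open Filter Topology

noncomputable section

namespace SchurDP

/-! ### Symmetric sequence spaces -/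

/-- The (zero-based) decreasing rearrangement of a bounded real sequence:
`x*(n) = inf {c ≥ 0 : #{i : |x i| > c} ≤ n}`. -/
def rearrangement (x : ℕ → ℝ) (n : ℕ) : ℝ :=
  sInf {c : ℝ | 0 ≤ c ∧ {i : ℕ | c < |x i|}.encard ≤ n}

/-- A symmetric sequence space on `ℕ`: a linear space `ℓ¹ ⊆ E ⊆ ℓ^∞` of real sequences, complete
in its own norm, such that `x ∈ E`, `y ∈ ℓ^∞` and `y* ≤ x*` imply `y ∈ E` and `‖y‖ ≤ ‖x‖`. -/
structure SymmetricSequenceSpace where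
  carrier : Submodule ℝ (ℕ → ℝ)
  norm : Seminorm ℝ carrier
  eq_zero_of_norm_eq_zero : ∀ x : carrier, norm x = 0 → x = 0
  complete : ∀ u : ℕ → carrier,
    (∀ ε : ℝ, 0 < ε → ∃ N : ℕ, ∀ m ≥ N, ∀ n ≥ N, norm (u m - u n) < ε) →
      ∃ x : carrier, Tendsto (fun n => norm (u n - x)) atTop (𝓝 0)
  mem_of_summable : ∀ x : ℕ → ℝ, Summable (fun i => |x i|) → x ∈ carrier
  bounded : ∀ x ∈ carrier, BddAbove (Set.range fun i => |x i|)
  symmetric : ∀ (x : carrier) (y : ℕ → ℝ), BddAbove (Set.range fun i => |y i|) →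
    (∀ n, rearrangement y n ≤ rearrangement x n) →
      ∃ hy : y ∈ carrier, norm ⟨y, hy⟩ ≤ norm x

lemma rearrangement_le_of_encard_le {x y : ℕ → ℝ} (hx : BddAbove (Set.range fun i => |x i|))
    (h : ∀ c : ℝ, 0 ≤ c → {i | c < |y i|}.encard ≤ {i | c < |x i|}.encard) (n : ℕ) :
    rearrangement y n ≤ rearrangement x n := by
  obtain ⟨C, hC⟩ := hx
  have hC' : ∀ i, |x i| ≤ C := fun i => hC ⟨i, rfl⟩
  refine csInf_le_csInf ⟨0, fun c hc => hc.1⟩ ⟨C, (abs_nonneg _).trans (hC' 0), ?_⟩ ?_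
  · have : {i | C < |x i|} = ∅ := by
      ext i
      simpa using hC' i
    simp [this]
  · rintro c ⟨hc, hcn⟩
    exact ⟨hc, (h c hc).trans hcn⟩

namespace SymmetricSequenceSpace

variable (E : SymmetricSequenceSpace)

lemma mem_of_encard_le {x y : ℕ → ℝ} (hx : x ∈ E.carrier)
    (h : ∀ c : ℝ, 0 ≤ c → {i | c < |y i|}.encard ≤ {i | c < |x i|}.encard) : y ∈ E.carrier := by
  have hb := E.bounded x hx
  obtain ⟨C, hC⟩ := id hb
  have hC' : ∀ i, |x i| ≤ C := fun i => hC ⟨i, rfl⟩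
  have hy : BddAbove (Set.range fun i => |y i|) := by
    refine ⟨C, ?_⟩
    rintro _ ⟨i, rfl⟩
    have h1 := h C ((abs_nonneg _).trans (hC' 0))
    have h2 : {i | C < |x i|} = ∅ := by
      ext i
      simpa using hC' i
    rw [h2, Set.encard_empty, nonpos_iff_eq_zero, Set.encard_eq_zero] at h1
    by_contra hlt
    have : i ∈ {i | C < |y i|} := not_le.mp hlt
    rw [h1] at this
    exact this
  obtain ⟨hm, -⟩ := E.symmetric ⟨x, hx⟩ y hy (rearrangement_le_of_encard_le hb h)
  exact hm

lemma mem_of_abs_le {x y : ℕ → ℝ} (hx : x ∈ E.carrier) (h : ∀ i, |y i| ≤ |x i|) :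
    y ∈ E.carrier :=
  E.mem_of_encard_le hx fun _ _ => Set.encard_le_encard fun i hi => lt_of_lt_of_le hi (h i)

lemma half_mem {x : ℕ → ℝ} (hx : x ∈ E.carrier) : (fun n => x (n / 2)) ∈ E.carrier := by
  have key : ∀ r : ℕ, (fun n => if n % 2 = r then x (n / 2) else 0) ∈ E.carrier := by
    intro r
    refine E.mem_of_encard_le hx fun c hc => ?_
    refine Set.encard_le_encard_of_injOn (f := fun n => n / 2) ?_ ?_
    · intro n hn
      simp only [Set.mem_ofPred_eq] at hn ⊢
      split_ifs at hn with h
      · exact hn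
      · simp at hn
        exact absurd hn (not_lt.mpr hc)
    · have aux : ∀ n : ℕ, c < |if n % 2 = r then x (n / 2) else 0| → n % 2 = r := by
        intro n hn
        by_contra hne
        rw [if_neg hne, abs_zero] at hn
        exact absurd hn (not_lt.mpr hc)
      intro m hm n hn hmn
      have h1 := aux m hm
      have h2 := aux n hn
      simp only at hmn
      omega
  have := E.carrier.add_mem (key 0) (key 1)
  refine (congrArg (· ∈ E.carrier) ?_).mp this
  funext n
  rcases Nat.mod_two_eq_zero_or_one n with h | h <;> simp [h]

end SymmetricSequenceSpace

/-! ### Singular numbers of operators on `ℓ²` -/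

/-- The complex Hilbert space `ℓ²`. -/
abbrev Ell2 : Type := lp (fun _ : ℕ => ℂ) 2

/-- The matrix entry `x_{ij} = ⟨x e_j, e_i⟩`, that is, the `i`-th coordinate of `x e_j`, with
respect to the canonical basis of `ℓ²`. -/
def entry (x : Ell2 →L[ℂ] Ell2) (i j : ℕ) : ℂ :=
  (x (lp.single 2 j (1 : ℂ))) i

/-- The (zero-based) singular numbers `s_n(x) = inf ‖x e‖`, over all orthogonal projections `e`
with `rank (1 - e) ≤ n`; here `K` is the range of `1 - e`. -/
def singularNumber (x : Ell2 →L[ℂ] Ell2) (n : ℕ) : ℝ :=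
  sInf {r : ℝ | ∃ (K : Submodule ℂ Ell2) (_ : FiniteDimensional ℂ K),
    Module.finrank ℂ K ≤ n ∧ r = ‖x ∘L Kᗮ.starProjection‖}

lemma singularNumber_set_bddBelow (x : Ell2 →L[ℂ] Ell2) (n : ℕ) :
    BddBelow {r : ℝ | ∃ (K : Submodule ℂ Ell2) (_ : FiniteDimensional ℂ K),
      Module.finrank ℂ K ≤ n ∧ r = ‖x ∘L Kᗮ.starProjection‖} := by
  refine ⟨0, ?_⟩
  rintro r ⟨K, _, -, rfl⟩
  exact norm_nonneg _

lemma singularNumber_set_nonempty (x : Ell2 →L[ℂ] Ell2) (n : ℕ) :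
    {r : ℝ | ∃ (K : Submodule ℂ Ell2) (_ : FiniteDimensional ℂ K),
      Module.finrank ℂ K ≤ n ∧ r = ‖x ∘L Kᗮ.starProjection‖}.Nonempty :=
  ⟨_, ⊥, inferInstance, by simp, rfl⟩

lemma singularNumber_nonneg (x : Ell2 →L[ℂ] Ell2) (n : ℕ) : 0 ≤ singularNumber x n := by
  refine le_csInf (singularNumber_set_nonempty x n) ?_
  rintro r ⟨K, _, -, rfl⟩
  exact norm_nonneg _

lemma singularNumber_antitone (x : Ell2 →L[ℂ] Ell2) {m n : ℕ} (h : m ≤ n) :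
    singularNumber x n ≤ singularNumber x m := by
  refine csInf_le_csInf (singularNumber_set_bddBelow x n) (singularNumber_set_nonempty x m) ?_
  rintro r ⟨K, hK, hn, rfl⟩
  exact ⟨K, hK, hn.trans h, rfl⟩

lemma singularNumber_zero (n : ℕ) : singularNumber 0 n = 0 := by
  refine le_antisymm (csInf_le (singularNumber_set_bddBelow 0 n) ?_) (singularNumber_nonneg 0 n)
  exact ⟨⊥, inferInstance, by simp, by simp⟩

lemma norm_comp_starProjection_le (x : Ell2 →L[ℂ] Ell2) {K L : Submodule ℂ Ell2}
    [FiniteDimensional ℂ K] [FiniteDimensional ℂ L] (h : K ≤ L) :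
    ‖x ∘L Lᗮ.starProjection‖ ≤ ‖x ∘L Kᗮ.starProjection‖ := by
  have h1 : x ∘L Lᗮ.starProjection = (x ∘L Kᗮ.starProjection) ∘L Lᗮ.starProjection := by
    ext1 v
    have : Kᗮ.starProjection (Lᗮ.starProjection v) = Lᗮ.starProjection v :=
      Submodule.starProjection_eq_self_iff.mpr
        (Submodule.orthogonal_le h (Submodule.starProjection_apply_mem _ _))
    simp only [ContinuousLinearMap.comp_apply, this]
  rw [h1]
  calc _ ≤ ‖x ∘L Kᗮ.starProjection‖ * ‖Lᗮ.starProjection‖ :=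
        ContinuousLinearMap.opNorm_comp_le _ _
    _ ≤ ‖x ∘L Kᗮ.starProjection‖ * 1 :=
        mul_le_mul_of_nonneg_left (Submodule.starProjection_norm_le _) (norm_nonneg _)
    _ = _ := mul_one _

lemma singularNumber_add_le (x y : Ell2 →L[ℂ] Ell2) (m n : ℕ) :
    singularNumber (x + y) (m + n) ≤ singularNumber x m + singularNumber y n := by
  refine le_of_forall_pos_lt_add fun ε hε => ?_
  obtain ⟨_, ⟨K, hK, hKm, rfl⟩, hx⟩ := exists_lt_of_csInf_lt (singularNumber_set_nonempty x m)
    (lt_add_of_pos_right (singularNumber x m) (half_pos hε))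
  obtain ⟨_, ⟨L, hL, hLn, rfl⟩, hy⟩ := exists_lt_of_csInf_lt (singularNumber_set_nonempty y n)
    (lt_add_of_pos_right (singularNumber y n) (half_pos hε))
  have h1 : singularNumber (x + y) (m + n) ≤ ‖(x + y) ∘L (K ⊔ L)ᗮ.starProjection‖ :=
    csInf_le (singularNumber_set_bddBelow _ _) ⟨K ⊔ L, inferInstance,
      (Submodule.finrank_add_le_finrank_add_finrank K L).trans (add_le_add hKm hLn), rfl⟩
  have h2 : ‖(x + y) ∘L (K ⊔ L)ᗮ.starProjection‖ ≤
      ‖x ∘L (K ⊔ L)ᗮ.starProjection‖ + ‖y ∘L (K ⊔ L)ᗮ.starProjection‖ := by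
    rw [ContinuousLinearMap.add_comp]
    exact norm_add_le _ _
  have h3 := norm_comp_starProjection_le x (le_sup_left : K ≤ K ⊔ L)
  have h4 := norm_comp_starProjection_le y (le_sup_right : L ≤ K ⊔ L)
  linarith

lemma singularNumber_add_le_half (x y : Ell2 →L[ℂ] Ell2) (n : ℕ) :
    singularNumber (x + y) n ≤ singularNumber x (n / 2) + singularNumber y (n / 2) :=
  (singularNumber_antitone _ (by omega)).trans (singularNumber_add_le x y (n / 2) (n / 2))

lemma singularNumber_smul_le (c : ℂ) (x : Ell2 →L[ℂ] Ell2) (n : ℕ) :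
    singularNumber (c • x) n ≤ ‖c‖ * singularNumber x n := by
  refine le_of_forall_pos_lt_add fun ε hε => ?_
  have hc : 0 < ‖c‖ + 1 := by positivity
  obtain ⟨_, ⟨K, hK, hKn, rfl⟩, hx⟩ := exists_lt_of_csInf_lt (singularNumber_set_nonempty x n)
    (lt_add_of_pos_right (singularNumber x n) (div_pos hε hc))
  have h1 : singularNumber (c • x) n ≤ ‖c‖ * ‖x ∘L Kᗮ.starProjection‖ := by
    refine csInf_le (singularNumber_set_bddBelow _ _) ⟨K, hK, hKn, ?_⟩
    rw [ContinuousLinearMap.smul_comp, norm_smul]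
  have h2 : ‖c‖ * ‖x ∘L Kᗮ.starProjection‖ ≤ ‖c‖ * (singularNumber x n + ε / (‖c‖ + 1)) :=
    mul_le_mul_of_nonneg_left hx.le (norm_nonneg _)
  have h3 : ‖c‖ * (ε / (‖c‖ + 1)) < ε := by
    rw [mul_div_assoc', div_lt_iff₀ hc]
    nlinarith
  linarith [mul_add ‖c‖ (singularNumber x n) (ε / (‖c‖ + 1))]

/-! ### The trace class and the Schatten spaces -/

/-- The trace class on `ℓ²`: operators with summable singular numbers. -/
def traceClass : Submodule ℂ (Ell2 →L[ℂ] Ell2) where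
  carrier := {x | Summable (singularNumber x)}
  zero_mem' := by
    have : singularNumber 0 = fun _ => 0 := funext singularNumber_zero
    simp only [Set.mem_ofPred_eq, this]
    exact summable_zero
  add_mem' := by
    intro x y hx hy
    have half : ∀ {a : ℕ → ℝ}, Summable a → Summable fun n => a (n / 2) := by
      intro a ha
      have h0 : Summable fun k => a (2 * k / 2) := by simpa using ha
      have h1 : Summable fun k => a ((2 * k + 1) / 2) := by
        have : ∀ k, (2 * k + 1) / 2 = k := by omega
        simpa [this] using ha
      exact (HasSum.even_add_odd (f := fun n => a (n / 2)) h0.hasSum h1.hasSum).summable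
    exact Summable.of_nonneg_of_le (singularNumber_nonneg _) (singularNumber_add_le_half x y)
      ((half hx).add (half hy))
  smul_mem' := by
    intro c x hx
    exact Summable.of_nonneg_of_le (singularNumber_nonneg _) (singularNumber_smul_le c x)
      (Summable.mul_left _ hx)

/-- The trace norm `‖x‖₁ = ∑ s_n(x)`. -/
def traceNorm (x : traceClass) : ℝ :=
  ∑' n, singularNumber (x : Ell2 →L[ℂ] Ell2) n

/-- The Schatten space of `E`: operators on `ℓ²` whose sequence of singular numbers is in `E`. -/
def schatten (E : SymmetricSequenceSpace) : Submodule ℂ (Ell2 →L[ℂ] Ell2) where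
  carrier := {x | singularNumber x ∈ E.carrier}
  zero_mem' := by
    have : singularNumber 0 = 0 := funext singularNumber_zero
    simp only [Set.mem_ofPred_eq, this]
    exact E.carrier.zero_mem
  add_mem' := by
    intro x y hx hy
    refine E.mem_of_abs_le (E.carrier.add_mem (E.half_mem hx) (E.half_mem hy)) fun n => ?_
    rw [abs_of_nonneg (singularNumber_nonneg _ _)]
    exact (singularNumber_add_le_half x y n).trans (le_abs_self _)
  smul_mem' := by
    intro c x hx
    refine E.mem_of_abs_le (E.carrier.smul_mem ‖c‖ hx) fun n => ?_
    rw [abs_of_nonneg (singularNumber_nonneg _ _)]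
    exact (singularNumber_smul_le c x n).trans (le_abs_self _)

/-- The norm `‖x‖ = ‖(s_n(x))_n‖_E` of the Schatten space of `E`. -/
def schattenNorm (E : SymmetricSequenceSpace) (x : schatten E) : ℝ :=
  E.norm ⟨singularNumber (x : Ell2 →L[ℂ] Ell2), x.2⟩

/-! ### Maps from the trace class to a Schatten space -/

variable {E : SymmetricSequenceSpace}

/-- `T` is the Schur multiplier with symbol `φ`: `(T x)_{ij} = φ_{ij} x_{ij}`. -/
def IsSchurMultiplier (T : traceClass →ₗ[ℂ] schatten E) (φ : ℕ → ℕ → ℂ) : Prop :=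
  ∀ (x : traceClass) (i j : ℕ), entry (T x) i j = φ i j * entry x i j

/-- `T ≥ 0`: `T` maps positive operators to positive operators. -/
def IsPositiveMap (T : traceClass →ₗ[ℂ] schatten E) : Prop :=
  ∀ x : traceClass, (x : Ell2 →L[ℂ] Ell2).IsPositive → (T x : Ell2 →L[ℂ] Ell2).IsPositive

/-- A sequence in the trace class is weakly null if every linear functional that is bounded with
respect to the trace norm maps it to a null sequence. -/
def IsWeaklyNull (u : ℕ → traceClass) : Prop :=
  ∀ f : traceClass →ₗ[ℂ] ℂ, (∃ C : ℝ, ∀ x, ‖f x‖ ≤ C * traceNorm x) →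
    Tendsto (fun n => f (u n)) atTop (𝓝 0)

/-- `T` is Dunford–Pettis: it maps weakly null sequences to norm null sequences. -/
def IsDunfordPettis (T : traceClass →ₗ[ℂ] schatten E) : Prop :=
  ∀ u : ℕ → traceClass, IsWeaklyNull u → Tendsto (fun n => schattenNorm E (T (u n))) atTop (𝓝 0)

end SchurDP

end

/-!
The symbols of `0 ≤ S_φ ≤ S_ψ` satisfy `0 ≤ φ ≤ ψ` as positive semidefinite kernels
(`IsPositiveMap.isPosSemidefKernel`). The proof characterizes, for such symbols, the Dunford–Pettis
property by the symbol alone, independently of the sequence space: the diagonal is bounded and every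
row tends to zero.

Necessity (`IsDunfordPettis.exists_diag_le`, `IsDunfordPettis.tendsto_row`) follows from testing on
multiples of matrix units, since the matrix units `e_{in}` of a fixed row tend weakly to zero in the
trace class.

For sufficiency (`IsPosSemidefKernel.isDunfordPettis`) let `u_n` be weakly null in the trace class.
A gliding hump argument (`IsWeaklyNull.exists_tailLE`) shows that the corners of `u_n` with both
indices at least `m` are small in trace norm, for a fixed `m` and all large `n`. By Schur's inequality
(`IsPosSemidefKernel.isContraction_mul`) multiplication by `φ` does not increase them by more than
the bound of the diagonal. In each of the remaining `m` rows and columns `u_n` is weakly null in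
`ℓ²`, and multiplication by the null sequence `φ_{i·}` makes it norm null
(`eventually_l2_mul_le`). So `S_φ u_n` tends to zero even in trace norm, which dominates the norm
of every symmetric sequence space.

It remains to see that `ψ_{ij} → 0` in every row forces `φ_{ij} → 0`
(`IsPosSemidefKernel.tendsto_row`). If `|φ_{ij}| ≥ δ` for infinitely many `j`, select `m` such
indices that are almost orthogonal for `ψ`. A suitable unimodular combination `v` of their unit
vectors has `φ(v, v) ≤ ψ(v, v) = O(m)`, while `|φ(e_i, v)| ≥ m δ`; this contradicts the
Cauchy–Schwarz inequality for large `m`.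

The trace norm is handled by duality: up to constants, it is the supremum of the pairings
`∑ W_{ij} x_{ij}` with finite contractive blocks `W`. One inequality
(`IsContraction.norm_pair_entry_le`) comes from a dyadic decomposition of `x`, the other
(`summable_singularNumber_of_pair_le`) from a greedy choice of orthonormal systems.
-/

namespace SchurDP

open scoped ComplexOrder InnerProductSpace

/-! ### Finite contractions -/

/-- The `ℓ²` norm of a sequence restricted to the finite set `s`. -/
noncomputable def l2 (s : Finset ℕ) (a : ℕ → ℂ) : ℝ := √(∑ i ∈ s, ‖a i‖ ^ 2)

/-- The bilinear pairing `∑ W_{ij} X_{ij}` of two matrices over the finite block `s × s`; it is the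
trace of `Wᵀ X`. -/
noncomputable def pair (s : Finset ℕ) (W X : ℕ → ℕ → ℂ) : ℂ := ∑ i ∈ s, ∑ j ∈ s, W i j * X i j

/-- The block `s × s` of the matrix `W` is a contraction of `ℓ²(s)`, expressed through its bilinear
form. The entries of `W` outside the block are irrelevant. -/
def IsContraction (s : Finset ℕ) (W : ℕ → ℕ → ℂ) : Prop :=
  ∀ a b : ℕ → ℂ, ‖pair s W fun i j => a i * b j‖ ≤ l2 s a * l2 s b

lemma l2_nonneg (s : Finset ℕ) (a : ℕ → ℂ) : 0 ≤ l2 s a := Real.sqrt_nonneg _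

lemma l2_sq (s : Finset ℕ) (a : ℕ → ℂ) : l2 s a ^ 2 = ∑ i ∈ s, ‖a i‖ ^ 2 :=
  Real.sq_sqrt (Finset.sum_nonneg fun _ _ => sq_nonneg _)

lemma pair_congr {s : Finset ℕ} {W X V Y : ℕ → ℕ → ℂ}
    (h : ∀ i ∈ s, ∀ j ∈ s, W i j * X i j = V i j * Y i j) : pair s W X = pair s V Y :=
  Finset.sum_congr rfl fun i hi => Finset.sum_congr rfl fun j hj => h i hi j hj

lemma l2_indicator {s t : Finset ℕ} (h : t ⊆ s) (a : ℕ → ℂ) :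
    l2 s (fun i => if i ∈ t then a i else 0) = l2 t a := by
  unfold l2
  congr 1
  rw [← Finset.sum_subset h]
  · exact Finset.sum_congr rfl fun i hi => by simp [hi]
  · intro i _ hi
    simp [hi]

lemma pair_of_support {s t : Finset ℕ} (h : t ⊆ s) {W X : ℕ → ℕ → ℂ}
    (hW : ∀ i ∈ s, ∀ j ∈ s, ¬ (i ∈ t ∧ j ∈ t) → W i j * X i j = 0) :
    pair s W X = pair t W X := by
  unfold pair
  rw [← Finset.sum_subset h]
  · refine Finset.sum_congr rfl fun i hi => ?_
    rw [← Finset.sum_subset h]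
    intro j hj hjt
    exact hW i (h hi) j hj fun hh => hjt hh.2
  · intro i hi hit
    exact Finset.sum_eq_zero fun j hj => hW i hi j hj fun hh => hit hh.1

lemma IsContraction.mono {s t : Finset ℕ} {W : ℕ → ℕ → ℂ} (hW : IsContraction s W) (h : t ⊆ s) :
    IsContraction t W := by
  intro a b
  have := hW (fun i => if i ∈ t then a i else 0) (fun i => if i ∈ t then b i else 0)
  rw [l2_indicator h, l2_indicator h, pair_of_support h] at this
  · rwa [pair_congr (Y := fun i j => a i * b j) (V := W) fun i hi j hj => by simp [hi, hj]] at this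
  · intro i _ j _ hij
    by_cases hi : i ∈ t
    · have : j ∉ t := fun hj => hij ⟨hi, hj⟩
      simp [this]
    · simp [hi]

lemma pair_smul_left (s : Finset ℕ) (c : ℂ) (W X : ℕ → ℕ → ℂ) :
    pair s (fun i j => c * W i j) X = c * pair s W X := by
  simp only [pair, Finset.mul_sum, mul_assoc]

lemma pair_smul_right (s : Finset ℕ) (c : ℂ) (W X : ℕ → ℕ → ℂ) :
    pair s W (fun i j => c * X i j) = c * pair s W X := by
  simp only [pair, Finset.mul_sum, mul_left_comm]

lemma pair_add_right (s : Finset ℕ) (W X Y : ℕ → ℕ → ℂ) :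
    pair s W (fun i j => X i j + Y i j) = pair s W X + pair s W Y := by
  simp only [pair, mul_add, Finset.sum_add_distrib]

lemma pair_sub_right (s : Finset ℕ) (W X Y : ℕ → ℕ → ℂ) :
    pair s W (fun i j => X i j - Y i j) = pair s W X - pair s W Y := by
  simp only [pair, mul_sub, Finset.sum_sub_distrib]

lemma pair_add_left (s : Finset ℕ) (W V X : ℕ → ℕ → ℂ) :
    pair s (fun i j => W i j + V i j) X = pair s W X + pair s V X := by
  simp only [pair, add_mul, Finset.sum_add_distrib]

lemma pair_sum_right {ι : Type*} (A : Finset ι) (s : Finset ℕ) (W : ℕ → ℕ → ℂ)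
    (X : ι → ℕ → ℕ → ℂ) :
    pair s W (fun i j => ∑ k ∈ A, X k i j) = ∑ k ∈ A, pair s W (X k) := by
  classical
  induction A using Finset.induction_on with
  | empty => simp [pair]
  | insert k A hk ih =>
    simp only [Finset.sum_insert hk]
    rw [pair_add_right, ih]

lemma IsContraction.const_mul {s : Finset ℕ} {W : ℕ → ℕ → ℂ} (hW : IsContraction s W) {c : ℂ}
    (hc : ‖c‖ ≤ 1) : IsContraction s fun i j => c * W i j := by
  intro a b
  rw [pair_smul_left, norm_mul]
  exact (mul_le_of_le_one_left (norm_nonneg _) hc).trans (hW a b)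

lemma isContraction_zero (s : Finset ℕ) : IsContraction s fun _ _ => 0 := by
  intro a b
  simpa [pair] using mul_nonneg (l2_nonneg s a) (l2_nonneg s b)

lemma l2_indicator_singleton {s : Finset ℕ} {i : ℕ} (hi : i ∈ s) :
    l2 s (fun k => if k = i then 1 else 0) = 1 := by
  have := l2_indicator (Finset.singleton_subset_iff.mpr hi) fun _ => 1
  simp only [Finset.mem_singleton] at this
  rw [this]
  simp [l2]

/-- A row of a contraction has norm at most one. -/
lemma IsContraction.norm_row_le {s : Finset ℕ} {W : ℕ → ℕ → ℂ} (hW : IsContraction s W) {i : ℕ}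
    (hi : i ∈ s) (b : ℕ → ℂ) : ‖∑ j ∈ s, W i j * b j‖ ≤ l2 s b := by
  have := hW (fun k => if k = i then 1 else 0) b
  rw [l2_indicator_singleton hi, one_mul] at this
  convert this using 2
  unfold pair
  symm
  rw [Finset.sum_eq_single i]
  · simp
  · intro k _ hk
    simp [hk]
  · exact fun h => absurd hi h

/-- A column of a contraction has norm at most one. -/
lemma IsContraction.norm_col_le {s : Finset ℕ} {W : ℕ → ℕ → ℂ} (hW : IsContraction s W) {j : ℕ}
    (hj : j ∈ s) (a : ℕ → ℂ) : ‖∑ i ∈ s, W i j * a i‖ ≤ l2 s a := by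
  have := hW a (fun k => if k = j then 1 else 0)
  rw [l2_indicator_singleton hj, mul_one] at this
  convert this using 2
  unfold pair
  refine Finset.sum_congr rfl fun i _ => ?_
  rw [Finset.sum_eq_single j]
  · simp
  · intro k _ hk
    simp [hk]
  · exact fun h => absurd hj h

lemma IsContraction.norm_le_one {s : Finset ℕ} {W : ℕ → ℕ → ℂ} (hW : IsContraction s W) {i j : ℕ}
    (hi : i ∈ s) (hj : j ∈ s) : ‖W i j‖ ≤ 1 := by
  have := hW.norm_row_le hi (fun k => if k = j then 1 else 0)
  rw [l2_indicator_singleton hj] at this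
  simpa [hj] using this

/-- The block-diagonal sum of two contractions is a contraction. -/
lemma IsContraction.exists_union {s t : Finset ℕ} (hst : Disjoint s t) {W V : ℕ → ℕ → ℂ}
    (hW : IsContraction s W) (hV : IsContraction t V) :
    ∃ U, IsContraction (s ∪ t) U ∧ ∀ X, pair (s ∪ t) U X = pair s W X + pair t V X := by
  classical
  set cut : Finset ℕ → (ℕ → ℕ → ℂ) → ℕ → ℕ → ℂ := fun r Z i j => if i ∈ r ∧ j ∈ r then Z i j else 0
    with hcut
  have hpair : ∀ r Z X, r ⊆ s ∪ t → pair (s ∪ t) (cut r Z) X = pair r Z X := by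
    intro r Z X hr
    rw [pair_of_support hr fun i _ j _ hij => by simp only [hcut, if_neg hij, zero_mul]]
    exact pair_congr fun i hi j hj => by simp [hcut, hi, hj]
  have key : ∀ X, pair (s ∪ t) (fun i j => cut s W i j + cut t V i j) X
      = pair s W X + pair t V X := by
    intro X
    rw [pair_add_left, hpair _ _ _ Finset.subset_union_left, hpair _ _ _ Finset.subset_union_right]
  refine ⟨_, fun a b => ?_, key⟩
  rw [key]
  refine (norm_add_le _ _).trans ((add_le_add (hW a b) (hV a b)).trans ?_)
  have h1 : ∀ c : ℕ → ℂ, l2 (s ∪ t) c ^ 2 = l2 s c ^ 2 + l2 t c ^ 2 := fun c => by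
    simp only [l2_sq, Finset.sum_union hst]
  refine abs_le_of_sq_le_sq' ?_ (mul_nonneg (l2_nonneg _ _) (l2_nonneg _ _)) |>.2
  rw [mul_pow, h1, h1]
  nlinarith [sq_nonneg (l2 s a * l2 t b - l2 t a * l2 s b)]

/-- Finitely many pairings with contractions on disjoint blocks add up, in absolute value, to a
single pairing with a contraction. -/
lemma exists_contraction_sum_norm {s : ℕ → Finset ℕ} {W : ℕ → ℕ → ℕ → ℂ}
    (hW : ∀ k, IsContraction (s k) (W k)) (A : Finset ℕ)
    (hs : (A : Set ℕ).PairwiseDisjoint s) (X : ℕ → ℕ → ℂ) :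
    ∃ U, IsContraction (A.biUnion s) U ∧
      pair (A.biUnion s) U X = (∑ k ∈ A, ‖pair (s k) (W k) X‖ : ℝ) := by
  classical
  induction A using Finset.induction_on with
  | empty => exact ⟨fun _ _ => 0, isContraction_zero _, by simp [pair]⟩
  | insert k A hk ih =>
    obtain ⟨U, hU, hUX⟩ := ih (hs.subset (by simp))
    obtain ⟨c, hc, hcX⟩ : ∃ c : ℂ, ‖c‖ = 1 ∧ ‖pair (s k) (W k) X‖ = c * pair (s k) (W k) X :=
      RCLike.exists_norm_eq_mul_self _
    have hdisj : Disjoint (s k) (A.biUnion s) := by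
      rw [Finset.disjoint_biUnion_right]
      intro j hj
      exact hs (by simp) (by simp [hj]) (fun h => hk (h ▸ hj))
    obtain ⟨U', hU', hU'X⟩ := IsContraction.exists_union hdisj ((hW k).const_mul hc.le) hU
    rw [Finset.biUnion_insert]
    refine ⟨U', hU', ?_⟩
    rw [hU'X, pair_smul_left, ← hcX, hUX, Finset.sum_insert hk]
    push_cast
    rfl

/-! ### Positive semidefinite kernels -/

/-- A positive semidefinite kernel on `ℕ`: an infinite Hermitian matrix all of whose finite
sections are positive semidefinite. -/
def IsPosSemidefKernel (φ : ℕ → ℕ → ℂ) : Prop :=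
  (∀ i j, φ j i = star (φ i j)) ∧
    ∀ (s : Finset ℕ) (w : ℕ → ℂ), 0 ≤ ∑ i ∈ s, ∑ j ∈ s, star (w i) * φ i j * w j

lemma IsPosSemidefKernel.diag_nonneg {φ : ℕ → ℕ → ℂ} (h : IsPosSemidefKernel φ) (i : ℕ) :
    0 ≤ φ i i := by
  simpa using h.2 {i} fun _ => 1

/-- The section of a positive semidefinite kernel on `s` is a Gram matrix; `B k i` is the `k`-th
coordinate of the `i`-th vector. -/
lemma IsPosSemidefKernel.exists_gram {φ : ℕ → ℕ → ℂ} (h : IsPosSemidefKernel φ) (s : Finset ℕ) :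
    ∃ B : ℕ → ℕ → ℂ, ∀ i ∈ s, ∀ j ∈ s, φ i j = ∑ k ∈ s, star (B k i) * B k j := by
  classical
  have hP : (Matrix.of fun i j : s => φ i j).PosSemidef := by
    refine Matrix.PosSemidef.of_dotProduct_mulVec_nonneg ?_ fun x => ?_
    · ext i j
      simp [h.1 j i]
    · have := h.2 s fun i => if hi : i ∈ s then x ⟨i, hi⟩ else 0
      rw [← Finset.sum_coe_sort s] at this
      convert this using 1
      simp only [dotProduct, Matrix.mulVec, Finset.mul_sum]
      refine Finset.sum_congr rfl fun i _ => ?_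
      rw [← Finset.sum_coe_sort s]
      refine Finset.sum_congr rfl fun j _ => ?_
      simp [mul_assoc]
  obtain ⟨B, hB⟩ : ∃ B : Matrix s s ℂ, (Matrix.of fun i j : s => φ i j) = star B * B := by
    open scoped MatrixOrder Matrix.Norms.L2Operator in
    exact CStarAlgebra.nonneg_iff_eq_star_mul_self.mp (Matrix.nonneg_iff_posSemidef.mpr hP)
  refine ⟨fun k i => if h : k ∈ s ∧ i ∈ s then B ⟨k, h.1⟩ ⟨i, h.2⟩ else 0, fun i hi j hj => ?_⟩
  have := congrFun (congrFun hB ⟨i, hi⟩) ⟨j, hj⟩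
  simp only [Matrix.of_apply, Matrix.mul_apply, Matrix.star_apply] at this
  rw [this, ← Finset.sum_coe_sort s]
  refine Finset.sum_congr rfl fun k _ => ?_
  simp [hi, hj]

/-- Schur's inequality: multiplication by a positive semidefinite kernel with diagonal at most `M`
has norm at most `M` on matrices. -/
lemma IsPosSemidefKernel.isContraction_mul {φ : ℕ → ℕ → ℂ} (h : IsPosSemidefKernel φ) {M : ℝ}
    (hM : 0 < M) (hφ : ∀ i, ‖φ i i‖ ≤ M) {s : Finset ℕ} {W : ℕ → ℕ → ℂ} (hW : IsContraction s W) :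
    IsContraction s fun i j => (M : ℂ)⁻¹ * (φ i j * W i j) := by
  intro a b
  obtain ⟨B, hB⟩ := h.exists_gram s
  have hdiag : ∀ i ∈ s, ∑ k ∈ s, ‖B k i‖ ^ 2 ≤ M := by
    intro i hi
    have h1 : φ i i = ((∑ k ∈ s, ‖B k i‖ ^ 2 : ℝ) : ℂ) := by
      rw [hB i hi i hi]
      push_cast
      exact Finset.sum_congr rfl fun k _ => by
        rw [← Complex.conj_mul']
        rfl
    have h2 := hφ i
    rw [h1, Complex.norm_real, Real.norm_eq_abs] at h2
    exact (le_abs_self _).trans h2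
  have hl2 : ∀ (c : ℕ → ℂ) (F : ℕ → ℕ → ℂ), (∀ k i, ‖F k i‖ = ‖B k i‖) →
      ∑ k ∈ s, l2 s (fun i => F k i * c i) ^ 2 ≤ M * l2 s c ^ 2 := by
    intro c F hF
    simp only [l2_sq, norm_mul, mul_pow, hF]
    rw [Finset.sum_comm, Finset.mul_sum]
    refine Finset.sum_le_sum fun i hi => ?_
    rw [← Finset.sum_mul]
    exact mul_le_mul_of_nonneg_right (hdiag i hi) (sq_nonneg _)
  have h1 : pair s (fun i j => φ i j * W i j) (fun i j => a i * b j)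
      = ∑ k ∈ s, pair s W (fun i j => (star (B k i) * a i) * (B k j * b j)) := by
    rw [← pair_sum_right]
    refine pair_congr fun i hi j hj => ?_
    rw [hB i hi j hj]
    simp only [Finset.mul_sum, Finset.sum_mul]
    exact Finset.sum_congr rfl fun k _ => by ring
  have h2 : ‖pair s (fun i j => φ i j * W i j) (fun i j => a i * b j)‖ ≤ M * (l2 s a * l2 s b) := by
    rw [h1]
    calc _ ≤ ∑ k ∈ s, l2 s (fun i => star (B k i) * a i) * l2 s (fun i => B k i * b i) :=
          norm_sum_le_of_le _ fun k _ => hW (fun i => star (B k i) * a i) fun j => B k j * b j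
      _ ≤ √(∑ k ∈ s, l2 s (fun i => star (B k i) * a i) ^ 2) *
            √(∑ k ∈ s, l2 s (fun i => B k i * b i) ^ 2) := Real.sum_mul_le_sqrt_mul_sqrt _ _ _
      _ ≤ √(M * l2 s a ^ 2) * √(M * l2 s b ^ 2) := by
          gcongr
          · exact hl2 a (fun k i => star (B k i)) fun k i => norm_star _
          · exact hl2 b B fun _ _ => rfl
      _ = M * (l2 s a * l2 s b) := by
          rw [Real.sqrt_mul hM.le, Real.sqrt_mul hM.le, Real.sqrt_sq (l2_nonneg _ _),
            Real.sqrt_sq (l2_nonneg _ _)]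
          linear_combination (l2 s a * l2 s b) * Real.mul_self_sqrt hM.le
  rw [pair_smul_left, norm_mul, norm_inv, Complex.norm_real, Real.norm_of_nonneg hM.le,
    inv_mul_le_iff₀ hM]
  exact h2

/-- Domination passes decay of the rows from a positive semidefinite kernel to a smaller one: if
`0 ≤ φ ≤ ψ`, the diagonal of `ψ` is bounded and the rows of `ψ` tend to zero, then so do the rows
of `φ`. -/
lemma IsPosSemidefKernel.tendsto_row {φ ψ : ℕ → ℕ → ℂ} (hφ : IsPosSemidefKernel φ)
    (hle : IsPosSemidefKernel fun i j => ψ i j - φ i j) {M : ℝ} (hM : ∀ i, ‖ψ i i‖ ≤ M)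
    (hMφ : ∀ i, ‖φ i i‖ ≤ M)
    (hψ : ∀ i, Tendsto (fun j => ψ i j) atTop (𝓝 0))
    (hψ' : ∀ j, Tendsto (fun i => ψ i j) atTop (𝓝 0)) (i : ℕ) :
    Tendsto (fun j => φ i j) atTop (𝓝 0) := by
  classical
  by_contra hnot
  rw [Metric.tendsto_atTop] at hnot
  push Not at hnot
  obtain ⟨δ, hδ, hfreq⟩ := hnot
  have hM0 : 0 ≤ M := (norm_nonneg _).trans (hM 0)
  -- Arbitrarily many indices with large entries of `φ` and almost orthogonal for `ψ`.
  have hF : ∀ m : ℕ, ∃ F : Finset ℕ, F.card = m ∧ i ∉ F ∧ (∀ j ∈ F, δ ≤ ‖φ i j‖) ∧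
      ∑ k ∈ F, ∑ l ∈ F, ‖ψ k l‖ ≤ m * (M + 1) := by
    intro m
    induction m with
    | zero => exact ⟨∅, by simp⟩
    | succ m ih =>
      obtain ⟨F, hcard, hiF, hFδ, hsum⟩ := ih
      have hlim : Tendsto (fun j => ∑ k ∈ F, (‖ψ k j‖ + ‖ψ j k‖)) atTop (𝓝 0) := by
        have := tendsto_finsetSum F fun k _ => (hψ k).norm.add (hψ' k).norm
        simpa using this
      obtain ⟨N, hN⟩ := eventually_atTop.mp (hlim.eventually (gt_mem_nhds one_pos))
      obtain ⟨j, hj, hjδ⟩ := hfreq (max N (max (i + 1) (F.sup id + 1)))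
      have hjF : j ∉ F := by
        intro h
        have : j ≤ F.sup id := Finset.le_sup (f := id) h
        omega
      have hji : i ≠ j := by omega
      refine ⟨insert j F, by simp [hjF, hcard], by simp [hji, hiF], ?_, ?_⟩
      · intro k hk
        rcases Finset.mem_insert.mp hk with rfl | hk
        · simpa using hjδ
        · exact hFδ k hk
      · have h1 := hN j (by omega)
        simp only [Finset.sum_insert hjF, Finset.sum_add_distrib] at h1 ⊢
        have := hM j
        push_cast
        linarith
  obtain ⟨m, hm⟩ := exists_nat_gt ((M + 1) ^ 2 / δ ^ 2)
  obtain ⟨F, hcard, hiF, hFδ, hsum⟩ := hF m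
  have hphase : ∀ j, ∃ c : ℂ, ‖c‖ = 1 ∧ ‖φ i j‖ = c * φ i j :=
    fun j => RCLike.exists_norm_eq_mul_self _
  choose θ hθ hθφ using hphase
  have hquad : (∑ k ∈ F, ∑ l ∈ F, star (θ k) * φ k l * θ l).re ≤ m * (M + 1) := by
    have h1 := (Complex.le_def.mp (hle.2 F θ)).1
    have h2 : ∑ k ∈ F, ∑ l ∈ F, star (θ k) * (ψ k l - φ k l) * θ l
        = ∑ k ∈ F, ∑ l ∈ F, star (θ k) * ψ k l * θ l
          - ∑ k ∈ F, ∑ l ∈ F, star (θ k) * φ k l * θ l := by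
      simp only [← Finset.sum_sub_distrib]
      exact Finset.sum_congr rfl fun k _ => Finset.sum_congr rfl fun l _ => by ring
    rw [h2, Complex.sub_re, Complex.zero_re] at h1
    have h3 : ‖∑ k ∈ F, ∑ l ∈ F, star (θ k) * ψ k l * θ l‖ ≤ ∑ k ∈ F, ∑ l ∈ F, ‖ψ k l‖ :=
      norm_sum_le_of_le _ fun k _ => norm_sum_le_of_le _ fun l _ => by simp [hθ]
    have h4 := (Complex.re_le_norm _).trans (h3.trans hsum)
    linarith
  -- Positivity of `φ` at `∑ θ_k e_k - c e_i` for real `c`.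
  have hpoly : ∀ c : ℝ, 0 ≤ m * (M + 1) - 2 * c * (m * δ) + c ^ 2 * M ∨ c < 0 := by
    intro c
    by_cases hc : c < 0
    · exact Or.inr hc
    left
    push Not at hc
    set w : ℕ → ℂ := fun k => if k = i then -(c : ℂ) else θ k with hw
    have hwi : w i = -(c : ℂ) := by simp [hw]
    have hwF : ∀ k ∈ F, w k = θ k := fun k hk => by
      have : k ≠ i := fun h => hiF (h ▸ hk)
      simp [hw, this]
    have h1 := (Complex.le_def.mp (hφ.2 (insert i F) w)).1
    have hrow : ∑ l ∈ F, star (w i) * φ i l * w l = -((c * ∑ l ∈ F, ‖φ i l‖ : ℝ) : ℂ) := by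
      push_cast
      rw [Finset.mul_sum, ← Finset.sum_neg_distrib]
      refine Finset.sum_congr rfl fun l hl => ?_
      rw [hwi, hwF l hl]
      have := hθφ l
      simp only [star_neg, Complex.star_def, Complex.conj_ofReal]
      linear_combination (c : ℂ) * this
    have hcol : ∑ k ∈ F, star (w k) * φ k i * w i = -((c * ∑ l ∈ F, ‖φ i l‖ : ℝ) : ℂ) := by
      rw [← Complex.conj_ofReal, ← map_neg, ← hrow, map_sum]
      refine Finset.sum_congr rfl fun l hl => ?_
      rw [hφ.1 i l]
      simp only [Complex.star_def, map_mul, Complex.conj_conj]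
      ring
    have hFF : ∑ k ∈ F, ∑ l ∈ F, star (w k) * φ k l * w l
        = ∑ k ∈ F, ∑ l ∈ F, star (θ k) * φ k l * θ l :=
      Finset.sum_congr rfl fun k hk => Finset.sum_congr rfl fun l hl => by
        rw [hwF k hk, hwF l hl]
    have hii : (star (w i) * φ i i * w i).re ≤ c ^ 2 * M := by
      refine (Complex.re_le_norm _).trans ?_
      rw [norm_mul, norm_mul, norm_star, hwi, norm_neg, Complex.norm_real, Real.norm_of_nonneg hc]
      nlinarith [hMφ i, sq_nonneg c]
    simp only [Finset.sum_insert hiF, Finset.sum_add_distrib] at h1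
    rw [hrow, hcol, hFF, Complex.zero_re] at h1
    simp only [Complex.add_re, Complex.neg_re, Complex.ofReal_re] at h1
    have h2 : m * δ ≤ ∑ l ∈ F, ‖φ i l‖ := by
      have := Finset.card_nsmul_le_sum F _ δ hFδ
      rwa [hcard, nsmul_eq_mul] at this
    nlinarith [mul_le_mul_of_nonneg_left h2 hc]
  -- The optimal `c`, up to replacing `M` by `M + 1`.
  rcases hpoly (m * δ / (M + 1)) with h | h
  · have hM1 : 0 < M + 1 := by linarith
    have hm0 : 0 < (m : ℝ) := lt_of_le_of_lt (by positivity) hm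
    have h1 : (m * δ / (M + 1)) ^ 2 * M ≤ (m * δ) ^ 2 / (M + 1) := by
      rw [div_pow, div_mul_eq_mul_div, div_le_div_iff₀ (by positivity) hM1]
      nlinarith [sq_nonneg (m * δ), mul_nonneg (sq_nonneg (m * δ)) hM1.le]
    have h2 : 2 * (m * δ / (M + 1)) * (m * δ) = 2 * ((m * δ) ^ 2 / (M + 1)) := by ring
    have h3 : (m * δ) ^ 2 / (M + 1) ≤ m * (M + 1) := by linarith
    rw [div_le_iff₀ hM1] at h3
    rw [div_lt_iff₀ (by positivity)] at hm
    nlinarith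
  · have : 0 ≤ m * δ / (M + 1) := by positivity
    linarith

/-! ### Coordinates in `ℓ²` -/

/-- The finitely supported vector of `ℓ²` with the coordinates of `a` on `s`. -/
noncomputable def trunc (s : Finset ℕ) (a : ℕ → ℂ) : Ell2 := ∑ i ∈ s, lp.single 2 i (a i)

lemma norm_trunc (s : Finset ℕ) (a : ℕ → ℂ) : ‖trunc s a‖ = l2 s a := by
  have := lp.norm_sum_single (p := 2) (by norm_num) a s
  simp only [ENNReal.toReal_ofNat, Real.rpow_two] at this
  rw [l2, ← this, Real.sqrt_sq (norm_nonneg _)]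
  rfl

lemma l2_coe_le_norm (s : Finset ℕ) (v : Ell2) : l2 s v ≤ ‖v‖ := by
  have := lp.sum_rpow_le_norm_rpow (p := 2) (by norm_num) v s
  simp only [ENNReal.toReal_ofNat, Real.rpow_two] at this
  exact Real.sqrt_le_iff.mpr ⟨norm_nonneg _, this⟩

lemma tendsto_trunc (v : Ell2) :
    Tendsto (fun N => trunc (Finset.range N) v) atTop (𝓝 v) :=
  (lp.hasSum_single (by norm_num) v).tendsto_sum_nat

lemma inner_single_one_left (i : ℕ) (v : Ell2) : ⟪(lp.single 2 i (1 : ℂ) : Ell2), v⟫_ℂ = v i := by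
  simp [lp.inner_single_left]

lemma inner_trunc_left (s : Finset ℕ) (a : ℕ → ℂ) (v : Ell2) :
    ⟪trunc s a, v⟫_ℂ = ∑ i ∈ s, star (a i) * v i := by
  simp [trunc, lp.inner_single_left, mul_comm]

lemma map_trunc (x : Ell2 →L[ℂ] Ell2) (s : Finset ℕ) (a : ℕ → ℂ) (i : ℕ) :
    x (trunc s a) i = ∑ j ∈ s, a j * entry x i j := by
  have h : ∀ j, (lp.single 2 j (a j) : Ell2) = a j • lp.single 2 j (1 : ℂ) := fun j => by
    rw [← lp.single_smul, smul_eq_mul, mul_one]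
  simp only [trunc, h, map_sum, map_smul, lp.coeFn_sum, Finset.sum_apply]
  rfl

lemma inner_trunc_map_trunc (x : Ell2 →L[ℂ] Ell2) (s : Finset ℕ) (a b : ℕ → ℂ) :
    ⟪trunc s a, x (trunc s b)⟫_ℂ = pair s (fun i j => star (a i) * b j) (entry x) := by
  simp only [inner_trunc_left, map_trunc, Finset.mul_sum, pair, mul_assoc]

lemma entry_add (x y : Ell2 →L[ℂ] Ell2) :
    entry (x + y) = fun i j => entry x i j + entry y i j := rfl

lemma entry_sub (x y : Ell2 →L[ℂ] Ell2) :
    entry (x - y) = fun i j => entry x i j - entry y i j := rfl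

lemma entry_smul (c : ℂ) (x : Ell2 →L[ℂ] Ell2) :
    entry (c • x) = fun i j => c * entry x i j := rfl

lemma entry_rankOne (a b : Ell2) (i j : ℕ) :
    entry (InnerProductSpace.rankOne ℂ a b) i j = a i * star (b j) := by
  simp [entry, InnerProductSpace.rankOne_apply, lp.inner_single_right, mul_comm]

lemma norm_single_one (j : ℕ) : ‖(lp.single 2 j (1 : ℂ) : Ell2)‖ = 1 := by
  rw [lp.norm_single (by norm_num), norm_one]

lemma norm_apply_single_le (x : Ell2 →L[ℂ] Ell2) (j : ℕ) : ‖x (lp.single 2 j (1 : ℂ))‖ ≤ ‖x‖ := by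
  simpa [norm_single_one] using x.le_opNorm (lp.single 2 j (1 : ℂ))

lemma norm_entry_le (x : Ell2 →L[ℂ] Ell2) (i j : ℕ) : ‖entry x i j‖ ≤ ‖x‖ :=
  (lp.norm_apply_le_norm two_ne_zero _ i).trans (norm_apply_single_le x j)

/-! ### Singular numbers dominate the pairing with contractions -/

/-- On operators of rank at most `r` the pairing with a contraction is bounded by `r` times the
operator norm: expand along an orthonormal basis of a space containing the range. -/
lemma IsContraction.norm_pair_entry_le_of_range {s : Finset ℕ} {W : ℕ → ℕ → ℂ}
    (hW : IsContraction s W) (y : Ell2 →L[ℂ] Ell2) (K : Submodule ℂ Ell2) [FiniteDimensional ℂ K]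
    (hy : ∀ v, y v ∈ K) : ‖pair s W (entry y)‖ ≤ Module.finrank ℂ K * ‖y‖ := by
  set b := stdOrthonormalBasis ℂ K with hb
  have hnorm : ∀ l, ‖(b l : Ell2)‖ = 1 := fun l => b.orthonormal.1 l
  have hexp : entry y = fun i j => ∑ l, (b l : Ell2) i *
      ⟪(b l : Ell2), y (lp.single 2 j (1 : ℂ))⟫_ℂ := by
    funext i j
    have h := congrArg (fun v : K => (v : Ell2) i) (b.sum_repr' ⟨_, hy (lp.single 2 j (1 : ℂ))⟩)
    simp only [Submodule.coe_sum, Submodule.coe_smul, lp.coeFn_sum, Finset.sum_apply,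
      Submodule.coe_inner] at h
    rw [entry, ← h]
    exact Finset.sum_congr rfl fun l _ => mul_comm _ _
  have hcol : ∀ l, l2 s (fun j => ⟪(b l : Ell2), y (lp.single 2 j (1 : ℂ))⟫_ℂ) ≤ ‖y‖ := by
    intro l
    have h1 : l2 s (fun j => ⟪(b l : Ell2), y (lp.single 2 j (1 : ℂ))⟫_ℂ)
        = l2 s (y.adjoint (b l : Ell2)) := by
      unfold l2
      congr 1
      refine Finset.sum_congr rfl fun j _ => ?_
      have h2 : ⟪(b l : Ell2), y (lp.single 2 j (1 : ℂ))⟫_ℂ = star (y.adjoint (b l : Ell2) j) := by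
        rw [← ContinuousLinearMap.adjoint_inner_left, ← inner_conj_symm, inner_single_one_left]
        rfl
      simp only [h2, norm_star]
    rw [h1]
    refine (l2_coe_le_norm _ _).trans ((y.adjoint.le_opNorm _).trans ?_)
    rw [hnorm, mul_one, LinearIsometryEquiv.norm_map]
  rw [hexp, pair_sum_right]
  refine (norm_sum_le_of_le _ (f := fun l => _) (n := fun _ => ‖y‖) fun l _ => ?_).trans ?_
  · refine (hW (b l : Ell2) fun j => ⟪(b l : Ell2), y (lp.single 2 j (1 : ℂ))⟫_ℂ).trans ?_
    calc _ ≤ 1 * ‖y‖ := mul_le_mul ((l2_coe_le_norm _ _).trans (hnorm l).le) (hcol l)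
          (l2_nonneg _ _) zero_le_one
      _ = ‖y‖ := one_mul _
  · simp

lemma singularNumber_zero_eq_norm (x : Ell2 →L[ℂ] Ell2) : singularNumber x 0 = ‖x‖ := by
  have h : ∀ r, (∃ (K : Submodule ℂ Ell2) (_ : FiniteDimensional ℂ K),
      Module.finrank ℂ K ≤ 0 ∧ r = ‖x ∘L Kᗮ.starProjection‖) ↔ r = ‖x‖ := by
    intro r
    constructor
    · rintro ⟨K, _, hK, rfl⟩
      obtain rfl : K = ⊥ := Submodule.finrank_eq_zero.mp (Nat.le_zero.mp hK)
      congr 1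
      ext1 v
      rw [ContinuousLinearMap.comp_apply, Submodule.starProjection_orthogonal_val]
      simp
    · rintro rfl
      refine ⟨⊥, inferInstance, by simp, ?_⟩
      congr 1
      ext1 v
      rw [ContinuousLinearMap.comp_apply, Submodule.starProjection_orthogonal_val]
      simp
  have h2 : singularNumber x 0 = sInf {r | r = ‖x‖} := by
    unfold singularNumber
    simp only [h]
  rw [h2]
  simp

lemma exists_norm_comp_lt (x : Ell2 →L[ℂ] Ell2) (n : ℕ) {η : ℝ} (hη : 0 < η) :
    ∃ (K : Submodule ℂ Ell2) (_ : FiniteDimensional ℂ K), Module.finrank ℂ K ≤ n ∧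
      ‖x ∘L Kᗮ.starProjection‖ < singularNumber x n + η := by
  obtain ⟨_, ⟨K, hK, hKn, rfl⟩, h⟩ := exists_lt_of_csInf_lt (singularNumber_set_nonempty x n)
    (lt_add_of_pos_right (singularNumber x n) hη)
  exact ⟨K, hK, hKn, h⟩

/-- Pairing with contractions is bounded by the trace norm, up to a constant. The operator is cut
into dyadic pieces `x e_{2^k} - x e_{2^{k+1}}`, of rank at most `3 · 2^k` and of norm about
`2 s_{2^k}(x)`; condensation turns the sum of rank times norm into the sum of the singular
numbers. -/
lemma IsContraction.norm_pair_entry_le {s : Finset ℕ} {W : ℕ → ℕ → ℂ} (hW : IsContraction s W)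
    {x : Ell2 →L[ℂ] Ell2} (hx : Summable (singularNumber x)) :
    ‖pair s W (entry x)‖ ≤ 13 * ∑' n, singularNumber x n := by
  set τ := ∑' n, singularNumber x n with hτ
  set D : ℝ := ∑ i ∈ s, ∑ j ∈ s, ‖W i j‖ with hD
  have hD0 : 0 ≤ D := Finset.sum_nonneg fun i _ => Finset.sum_nonneg fun j _ => norm_nonneg _
  have hcrude : ∀ y : Ell2 →L[ℂ] Ell2, ‖pair s W (entry y)‖ ≤ D * ‖y‖ := by
    intro y
    rw [hD, Finset.sum_mul]
    refine norm_sum_le_of_le _ fun i _ => ?_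
    rw [Finset.sum_mul]
    refine norm_sum_le_of_le _ fun j _ => ?_
    rw [norm_mul]
    exact mul_le_mul_of_nonneg_left (norm_entry_le y i j) (norm_nonneg _)
  have main : ∀ η : ℝ, 0 < η → ‖pair s W (entry x)‖ ≤ 13 * τ + (12 + 2 * D) * η := by
    intro η hη
    -- The errors `η / 4 ^ k` stay summable after multiplication with the ranks `3 · 2 ^ k`.
    choose K hK hdim hnorm using fun k : ℕ =>
      exists_norm_comp_lt x (2 ^ k) (η := η / 4 ^ k) (by positivity)
    set e : ℕ → (Ell2 →L[ℂ] Ell2) := fun k => x ∘L (K k)ᗮ.starProjection with he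
    have hstep : ∀ k, ‖pair s W (entry (e k)) - pair s W (entry (e (k + 1)))‖
        ≤ 6 * (2 ^ k * singularNumber x (2 ^ k)) + 6 * η * (1 / 2) ^ k := by
      intro k
      rw [← pair_sub_right, ← entry_sub]
      have hmem : ∀ v, (e k - e (k + 1)) v ∈ (K k ⊔ K (k + 1)).map (x : Ell2 →ₗ[ℂ] Ell2) := by
        intro v
        refine ⟨(K (k + 1)).starProjection v - (K k).starProjection v, ?_, ?_⟩
        · exact Submodule.sub_mem _
            (Submodule.mem_sup_right (Submodule.starProjection_apply_mem _ _))
            (Submodule.mem_sup_left (Submodule.starProjection_apply_mem _ _))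
        · simp [he, Submodule.starProjection_orthogonal_val]
      refine (hW.norm_pair_entry_le_of_range _ _ hmem).trans ?_
      have h1 : (Module.finrank ℂ ((K k ⊔ K (k + 1)).map (x : Ell2 →ₗ[ℂ] Ell2)) : ℝ)
          ≤ 3 * 2 ^ k := by
        have h := (Submodule.finrank_map_le (x : Ell2 →ₗ[ℂ] Ell2) (K k ⊔ K (k + 1))).trans
          ((Submodule.finrank_add_le_finrank_add_finrank _ _).trans
            (add_le_add (hdim k) (hdim (k + 1))))
        have h' : 2 ^ k + 2 ^ (k + 1) = 3 * 2 ^ k := by ring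
        rw [h'] at h
        exact_mod_cast h
      have h2 : ‖e k - e (k + 1)‖ ≤ 2 * singularNumber x (2 ^ k) + 2 * (η / 4 ^ k) := by
        have h3 := norm_sub_le (e k) (e (k + 1))
        have h4 := hnorm k
        have h5 := hnorm (k + 1)
        have h6 := singularNumber_antitone x (pow_le_pow_right₀ (one_le_two) k.le_succ)
        have h7 : η / 4 ^ (k + 1) ≤ η / 4 ^ k :=
          div_le_div_of_nonneg_left hη.le (by positivity)
            (pow_le_pow_right₀ (by norm_num) k.le_succ)
        simp only [Nat.succ_eq_add_one] at h6
        linarith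
      calc _ ≤ (3 * 2 ^ k) * (2 * singularNumber x (2 ^ k) + 2 * (η / 4 ^ k)) :=
            mul_le_mul h1 h2 (norm_nonneg _) (by positivity)
        _ = _ := by
            have : (4 : ℝ) ^ k = 2 ^ k * 2 ^ k := by rw [← mul_pow]; norm_num
            rw [this, one_div, inv_pow]
            field_simp
            ring
    have hfirst : ‖pair s W (entry x) - pair s W (entry (e 0))‖ ≤ singularNumber x 0 := by
      rw [← pair_sub_right, ← entry_sub]
      have hmem : ∀ v, (x - e 0) v ∈ (K 0).map (x : Ell2 →ₗ[ℂ] Ell2) := by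
        intro v
        refine ⟨(K 0).starProjection v, Submodule.starProjection_apply_mem _ _, ?_⟩
        simp [he, Submodule.starProjection_orthogonal_val]
      refine (hW.norm_pair_entry_le_of_range _ _ hmem).trans ?_
      have h1 : (Module.finrank ℂ ((K 0).map (x : Ell2 →ₗ[ℂ] Ell2)) : ℝ) ≤ 1 := by
        have h := (Submodule.finrank_map_le (x : Ell2 →ₗ[ℂ] Ell2) (K 0)).trans (hdim 0)
        exact_mod_cast h
      have h2 : ‖x - e 0‖ ≤ ‖x‖ := by
        have : x - e 0 = x ∘L (K 0).starProjection := by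
          ext1 v
          simp [he, Submodule.starProjection_orthogonal_val]
        rw [this]
        exact (ContinuousLinearMap.opNorm_comp_le _ _).trans
          (mul_le_of_le_one_right (norm_nonneg _) (Submodule.starProjection_norm_le _))
      rw [singularNumber_zero_eq_norm]
      calc _ ≤ 1 * ‖x‖ := mul_le_mul h1 h2 (norm_nonneg _) zero_le_one
        _ = ‖x‖ := one_mul _
    -- Beyond a large dyadic index the remainder is controlled by the crude bound.
    obtain ⟨N, hN⟩ : ∃ N, singularNumber x (2 ^ N) < η := by
      have h := hx.tendsto_atTop_zero.comp (tendsto_pow_atTop_atTop_of_one_lt (one_lt_two (α := ℕ)))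
      exact (h.eventually (gt_mem_nhds hη)).exists
    have hlast : ‖pair s W (entry (e N))‖ ≤ D * (2 * η) := by
      refine (hcrude _).trans (mul_le_mul_of_nonneg_left ?_ hD0)
      have h1 := hnorm N
      have h2 : η / 4 ^ N ≤ η := div_le_self hη.le (one_le_pow₀ (by norm_num))
      linarith
    have hsum : ‖pair s W (entry (e 0)) - pair s W (entry (e N))‖
        ≤ 6 * ∑ k ∈ Finset.range N, 2 ^ k * singularNumber x (2 ^ k) + 12 * η := by
      rw [← Finset.sum_range_sub' fun k => pair s W (entry (e k))]
      refine (norm_sum_le_of_le _ fun k _ => hstep k).trans ?_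
      rw [Finset.sum_add_distrib, ← Finset.mul_sum, ← Finset.mul_sum]
      have := sum_geometric_two_le N
      nlinarith
    have hcond : ∑ k ∈ Finset.range N, 2 ^ k * singularNumber x (2 ^ k)
        ≤ 2 * (τ - singularNumber x 0) := by
      have h1 := Finset.sum_condensed_le (f := singularNumber x)
        (fun m n _ hmn => singularNumber_antitone x hmn) N
      have h2 : ∑ k ∈ Finset.range N, 2 ^ k * singularNumber x (2 ^ k)
          ≤ ∑ k ∈ Finset.range (N + 1), 2 ^ k • singularNumber x (2 ^ k) := by
        rw [Finset.sum_range_succ]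
        simp only [nsmul_eq_mul, Nat.cast_pow, Nat.cast_ofNat]
        exact le_add_of_nonneg_right (mul_nonneg (by positivity) (singularNumber_nonneg _ _))
      have h3 : singularNumber x 0 + singularNumber x 1
          + ∑ k ∈ Finset.Ico 2 (2 ^ N + 1), singularNumber x k ≤ τ := by
        have h4 := hx.sum_le_tsum (Finset.range (2 ^ N + 1)) fun n _ => singularNumber_nonneg x n
        have h5 : 2 ≤ 2 ^ N + 1 := by
          have := Nat.one_le_two_pow (n := N)
          omega
        rw [← Finset.sum_range_add_sum_Ico _ h5] at h4
        simpa [Finset.sum_range_succ] using h4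
      have h6 : 0 ≤ ∑ k ∈ Finset.Ico 2 (2 ^ N + 1), singularNumber x k :=
        Finset.sum_nonneg fun n _ => singularNumber_nonneg x n
      have h7 := singularNumber_nonneg x 1
      simp only [nsmul_eq_mul, Nat.cast_ofNat] at h1 h2
      linarith
    have h1 : pair s W (entry x) = (pair s W (entry x) - pair s W (entry (e 0)))
        + (pair s W (entry (e 0)) - pair s W (entry (e N))) + pair s W (entry (e N)) := by ring
    have h2 : singularNumber x 0 ≤ τ := hx.le_tsum 0 fun n _ => singularNumber_nonneg x n
    have h3 := singularNumber_nonneg x 0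
    rw [h1]
    refine (norm_add₃_le).trans ?_
    nlinarith
  refine le_of_forall_pos_le_add fun δ hδ => ?_
  have h := main (δ / (12 + 2 * D)) (by positivity)
  rwa [mul_div_cancel₀ _ (by positivity)] at h

/-! ### Pairings with contractions dominate the singular numbers -/

lemma orthonormal_option {ι : Type} {e : ι → Ell2} (he : Orthonormal ℂ e) {a : Ell2}
    (ha : ‖a‖ = 1) (h : ∀ i, ⟪e i, a⟫_ℂ = 0) :
    Orthonormal ℂ fun o : Option ι => o.elim a e := by
  refine ⟨fun o => ?_, fun o p hop => ?_⟩
  · cases o with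
    | none => exact ha
    | some i => exact he.1 i
  · cases o with
    | none =>
      cases p with
      | none => exact absurd rfl hop
      | some j => exact inner_eq_zero_symm.mp (h j)
    | some i =>
      cases p with
      | none => exact h i
      | some j => exact he.2 fun hij => hop (congrArg some hij)

lemma exists_unit_vector_orthogonal (y : Ell2 →L[ℂ] Ell2) (S : Submodule ℂ Ell2)
    [FiniteDimensional ℂ S] {n : ℕ} (hS : Module.finrank ℂ S ≤ n) (hn : 0 < singularNumber y n) :
    ∃ e ∈ Sᗮ, ‖e‖ = 1 ∧ singularNumber y n / 2 ≤ ‖y e‖ := by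
  have h1 : singularNumber y n / 2 < ‖y ∘L Sᗮ.starProjection‖ :=
    lt_of_lt_of_le (half_lt_self hn)
      (csInf_le (singularNumber_set_bddBelow y n) ⟨S, inferInstance, hS, rfl⟩)
  obtain ⟨v, hv, hyv⟩ := ContinuousLinearMap.exists_lt_apply_of_lt_opNorm _ h1
  set w := Sᗮ.starProjection v with hw
  rw [ContinuousLinearMap.comp_apply, ← hw] at hyv
  have hw1 : ‖w‖ ≤ 1 := by
    refine (Sᗮ.starProjection.le_opNorm v).trans ?_
    calc _ ≤ 1 * ‖v‖ := mul_le_mul_of_nonneg_right (Submodule.starProjection_norm_le _)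
          (norm_nonneg _)
      _ ≤ 1 := by linarith
  have hw0 : 0 < ‖w‖ := by
    refine norm_pos_iff.mpr fun h => ?_
    rw [h, map_zero, norm_zero] at hyv
    linarith
  refine ⟨(‖w‖⁻¹ : ℂ) • w, Submodule.smul_mem _ _ (Submodule.starProjection_apply_mem _ _), ?_, ?_⟩
  · rw [norm_smul, norm_inv, Complex.norm_real, norm_norm, inv_mul_cancel₀ hw0.ne']
  · rw [map_smul, norm_smul, norm_inv, Complex.norm_real, norm_norm]
    exact hyv.le.trans (le_mul_of_one_le_left (norm_nonneg _) ((one_le_inv₀ hw0).mpr hw1))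

/-- Greedy choice of orthonormal systems `e`, `f` for which `∑ ⟪f_i, y e_i⟫` controls the singular
numbers of even index. Each new vector `e` is taken orthogonal to the previous `e_i` and to the
vectors `y† f_i`, so that the normalization `f` of `y e` is orthogonal to the previous `f_i`; this
costs two dimensions per step. -/
lemma exists_orthonormal_sum_singularNumber_le (y : Ell2 →L[ℂ] Ell2) (m : ℕ) :
    ∃ (ι : Type) (_ : Fintype ι) (e f : ι → Ell2), Orthonormal ℂ e ∧ Orthonormal ℂ f ∧
      Fintype.card ι ≤ m ∧
      ∑ n ∈ Finset.range m, singularNumber y (2 * n) ≤ 2 * (∑ i, ⟪f i, y (e i)⟫_ℂ).re := by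
  induction m with
  | zero =>
    refine ⟨Empty, inferInstance, Empty.elim, Empty.elim, ?_, ?_, by simp, by simp⟩ <;>
    exact ⟨fun i => i.elim, fun i => i.elim⟩
  | succ m ih =>
    obtain ⟨ι, _, e, f, he, hf, hcard, hsum⟩ := ih
    rcases (singularNumber_nonneg y (2 * m)).eq_or_lt with h0 | hpos
    · refine ⟨ι, inferInstance, e, f, he, hf, hcard.trans m.le_succ, ?_⟩
      rw [Finset.sum_range_succ, ← h0, add_zero]
      exact hsum
    · set S := Submodule.span ℂ (Set.range e) ⊔
        Submodule.span ℂ (Set.range fun i => y.adjoint (f i)) with hS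
      have : FiniteDimensional ℂ (Submodule.span ℂ (Set.range e)) :=
        FiniteDimensional.span_of_finite ℂ (Set.finite_range _)
      have : FiniteDimensional ℂ (Submodule.span ℂ (Set.range fun i => y.adjoint (f i))) :=
        FiniteDimensional.span_of_finite ℂ (Set.finite_range _)
      have hrank : Module.finrank ℂ S ≤ 2 * m := by
        refine (Submodule.finrank_add_le_finrank_add_finrank _ _).trans ?_
        have h1 := finrank_range_le_card (R := ℂ) e
        have h2 := finrank_range_le_card (R := ℂ) fun i => y.adjoint (f i)
        unfold Set.finrank at h1 h2
        omega
      obtain ⟨a, haS, ha1, hya⟩ := exists_unit_vector_orthogonal y S hrank hpos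
      have hy0 : 0 < ‖y a‖ := by linarith
      have hae : ∀ i, ⟪e i, a⟫_ℂ = 0 := fun i =>
        Submodule.inner_right_of_mem_orthogonal
          (Submodule.mem_sup_left (Submodule.subset_span (Set.mem_range_self i))) haS
      have haf : ∀ i, ⟪f i, y a⟫_ℂ = 0 := fun i => by
        rw [← ContinuousLinearMap.adjoint_inner_left]
        exact Submodule.inner_right_of_mem_orthogonal (K := S) (Submodule.mem_sup_right
          (Submodule.subset_span (Set.mem_range_self (f := fun i => y.adjoint (f i)) i))) haS
      set b : Ell2 := (‖y a‖⁻¹ : ℂ) • y a with hb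
      have hb1 : ‖b‖ = 1 := by
        rw [hb, norm_smul, norm_inv, Complex.norm_real, norm_norm, inv_mul_cancel₀ hy0.ne']
      have hbf : ∀ i, ⟪f i, b⟫_ℂ = 0 := fun i => by rw [hb, inner_smul_right, haf, mul_zero]
      have hbya : ⟪b, y a⟫_ℂ = ‖y a‖ := by
        have h1 : (‖y a‖ : ℂ) ≠ 0 := by exact_mod_cast hy0.ne'
        rw [hb, inner_smul_left, inner_self_eq_norm_sq_to_K]
        simp only [map_inv₀, Complex.conj_ofReal, Complex.coe_algebraMap]
        field_simp
      refine ⟨Option ι, inferInstance, fun o => o.elim a e, fun o => o.elim b f,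
        orthonormal_option he ha1 hae, orthonormal_option hf hb1 hbf, by simpa using hcard, ?_⟩
      rw [Finset.sum_range_succ, Fintype.sum_option]
      simp only [Option.elim, hbya, Complex.add_re, Complex.ofReal_re]
      linarith

/-- Bessel's inequality: the matrix `∑ₗ conj (f_l) ⊗ e_l` of two orthonormal systems is a
contraction. -/
lemma isContraction_of_orthonormal {ι : Type} [Fintype ι] {e f : ι → Ell2}
    (he : Orthonormal ℂ e) (hf : Orthonormal ℂ f) (s : Finset ℕ) :
    IsContraction s fun i j => ∑ l, star (f l i) * e l j := by
  have bessel : ∀ {g : ι → Ell2}, Orthonormal ℂ g → ∀ a : ℕ → ℂ,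
      √(∑ l, ‖⟪g l, trunc s a⟫_ℂ‖ ^ 2) ≤ l2 s a := by
    intro g hg a
    rw [← norm_trunc]
    exact Real.sqrt_le_iff.mpr ⟨norm_nonneg _, hg.sum_inner_products_le _⟩
  intro a b
  have h1 : pair s (fun i j => ∑ l, star (f l i) * e l j) (fun i j => a i * b j)
      = ∑ l, ⟪f l, trunc s a⟫_ℂ * star ⟪e l, trunc s fun j => star (b j)⟫_ℂ := by
    have h2 : ∀ (g : Ell2) (c : ℕ → ℂ), ⟪g, trunc s c⟫_ℂ = ∑ i ∈ s, c i * star (g i) := by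
      intro g c
      rw [← inner_conj_symm, inner_trunc_left]
      simp [mul_comm]
    simp only [h2, pair, star_sum, star_mul, star_star, Finset.sum_mul_sum]
    rw [Finset.sum_comm]
    simp only [Finset.sum_mul]
    simp only [Finset.sum_comm (s := s) (t := Finset.univ)]
    refine Finset.sum_congr rfl fun l _ => ?_
    rw [Finset.sum_comm]
    exact Finset.sum_congr rfl fun i _ => Finset.sum_congr rfl fun j _ => by ring
  rw [h1]
  calc _ ≤ ∑ l, ‖⟪f l, trunc s a⟫_ℂ‖ * ‖⟪e l, trunc s fun j => star (b j)⟫_ℂ‖ :=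
        norm_sum_le_of_le _ fun l _ => by rw [norm_mul, norm_star]
    _ ≤ √(∑ l, ‖⟪f l, trunc s a⟫_ℂ‖ ^ 2) *
          √(∑ l, ‖⟪e l, trunc s fun j => star (b j)⟫_ℂ‖ ^ 2) := Real.sum_mul_le_sqrt_mul_sqrt _ _ _
    _ ≤ l2 s a * l2 s (fun j => star (b j)) :=
        mul_le_mul (bessel hf a) (bessel he _) (Real.sqrt_nonneg _) (l2_nonneg _ _)
    _ = l2 s a * l2 s b := by simp [l2]

lemma norm_sum_inner_le {y : Ell2 →L[ℂ] Ell2} {B : ℝ}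
    (hy : ∀ s W, IsContraction s W → ‖pair s W (entry y)‖ ≤ B) {ι : Type} [Fintype ι]
    {e f : ι → Ell2} (he : Orthonormal ℂ e) (hf : Orthonormal ℂ f) :
    ‖∑ l, ⟪f l, y (e l)⟫_ℂ‖ ≤ B := by
  have hlim : Tendsto (fun N => ∑ l, ⟪trunc (Finset.range N) (f l),
      y (trunc (Finset.range N) (e l))⟫_ℂ) atTop (𝓝 (∑ l, ⟪f l, y (e l)⟫_ℂ)) :=
    tendsto_finsetSum _ fun l _ =>
      (tendsto_trunc (f l)).inner ((y.continuous.tendsto _).comp (tendsto_trunc (e l)))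
  refine le_of_tendsto hlim.norm (Eventually.of_forall fun N => ?_)
  have h1 := hy _ _ (isContraction_of_orthonormal he hf (Finset.range N))
  have h2 : ∑ l, ⟪trunc (Finset.range N) (f l), y (trunc (Finset.range N) (e l))⟫_ℂ
      = pair (Finset.range N) (fun i j => ∑ l, star (f l i) * e l j) (entry y) := by
    simp only [inner_trunc_map_trunc, pair, Finset.sum_mul]
    rw [Finset.sum_comm]
    exact Finset.sum_congr rfl fun i _ => Finset.sum_comm
  rwa [h2]

/-- An operator whose pairings with contractions are bounded by `B` has trace norm at most
`4 B`. -/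
lemma summable_singularNumber_of_pair_le {y : Ell2 →L[ℂ] Ell2} {B : ℝ}
    (hy : ∀ s W, IsContraction s W → ‖pair s W (entry y)‖ ≤ B) :
    Summable (singularNumber y) ∧ ∑' n, singularNumber y n ≤ 4 * B := by
  have hB : ∀ m, ∑ n ∈ Finset.range m, singularNumber y n ≤ 4 * B := by
    intro m
    have h1 : ∑ n ∈ Finset.range m, singularNumber y n
        ≤ 2 * ∑ n ∈ Finset.range m, singularNumber y (2 * n) := by
      calc _ ≤ ∑ n ∈ Finset.range (2 * m), singularNumber y n :=
            Finset.sum_le_sum_of_subset_of_nonneg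
              (Finset.range_subset_range.mpr (by omega)) fun n _ _ => singularNumber_nonneg y n
        _ ≤ _ := by
            clear hy
            induction m with
            | zero => simp
            | succ m ih =>
              rw [Nat.mul_succ, Finset.sum_range_succ, Finset.sum_range_succ,
                Finset.sum_range_succ _ m]
              have := singularNumber_antitone y (Nat.le_succ (2 * m))
              simp only [Nat.succ_eq_add_one] at this
              linarith
    obtain ⟨ι, _, e, f, he, hf, -, hsum⟩ := exists_orthonormal_sum_singularNumber_le y m
    have h2 := (Complex.re_le_norm _).trans (norm_sum_inner_le hy he hf)
    linarith
  exact ⟨summable_of_sum_range_le (singularNumber_nonneg y) hB,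
    Real.tsum_le_of_sum_range_le (singularNumber_nonneg y) hB⟩

/-! ### Rank-one operators -/

lemma singularNumber_rankOne_succ (a b : Ell2) (n : ℕ) :
    singularNumber (InnerProductSpace.rankOne ℂ a b) (n + 1) = 0 := by
  refine le_antisymm (csInf_le (singularNumber_set_bddBelow _ _) ?_) (singularNumber_nonneg _ _)
  have : FiniteDimensional ℂ (Submodule.span ℂ {b}) :=
    FiniteDimensional.span_of_finite ℂ (Set.finite_singleton b)
  refine ⟨Submodule.span ℂ {b}, this, ?_, ?_⟩
  · have h := finrank_span_le_card (R := ℂ) ({b} : Set Ell2)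
    simp only [Set.toFinset_singleton, Finset.card_singleton] at h
    omega
  · symm
    rw [norm_eq_zero]
    ext1 v
    rw [ContinuousLinearMap.comp_apply, InnerProductSpace.rankOne_apply,
      Submodule.inner_right_of_mem_orthogonal (Submodule.mem_span_singleton_self b)
        (Submodule.starProjection_apply_mem _ _), zero_smul]
    rfl

lemma hasSum_singularNumber_rankOne (a b : Ell2) :
    HasSum (singularNumber (InnerProductSpace.rankOne ℂ a b)) (‖a‖ * ‖b‖) := by
  have h := hasSum_single (f := singularNumber (InnerProductSpace.rankOne ℂ a b)) 0 fun n hn => by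
    obtain ⟨n, rfl⟩ := Nat.exists_eq_succ_of_ne_zero hn
    exact singularNumber_rankOne_succ a b n
  rwa [singularNumber_zero_eq_norm, InnerProductSpace.norm_rankOne] at h

/-- The rank-one operator `v ↦ ⟪b, v⟫ a` as an element of the trace class. -/
noncomputable def traceRankOne (a b : Ell2) : traceClass :=
  ⟨InnerProductSpace.rankOne ℂ a b, (hasSum_singularNumber_rankOne a b).summable⟩

lemma traceNorm_traceRankOne (a b : Ell2) : traceNorm (traceRankOne a b) = ‖a‖ * ‖b‖ :=
  (hasSum_singularNumber_rankOne a b).tsum_eq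

lemma norm_le_traceNorm (x : traceClass) : ‖(x : Ell2 →L[ℂ] Ell2)‖ ≤ traceNorm x := by
  rw [← singularNumber_zero_eq_norm]
  exact Summable.le_tsum (f := singularNumber (x : Ell2 →L[ℂ] Ell2)) x.2 0
    fun n _ => singularNumber_nonneg _ n

/-! ### The norm of a symmetric sequence space -/

namespace SymmetricSequenceSpace

variable (E : SymmetricSequenceSpace)

/-- The `i`-th unit sequence as an element of a symmetric sequence space. -/
noncomputable def unit (i : ℕ) : E.carrier :=
  ⟨Pi.single i 1, E.mem_of_summable _ (summable_of_ne_finset_zero (s := {i}) fun j hj => by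
    simp [Finset.mem_singleton.not.mp hj])⟩

lemma unit_norm_pos (i : ℕ) : 0 < E.norm (E.unit i) := by
  refine (apply_nonneg E.norm _).lt_of_ne fun h => ?_
  have h1 := congrArg (fun x : E.carrier => (x : ℕ → ℝ) i) (E.eq_zero_of_norm_eq_zero _ h.symm)
  simp [unit] at h1

lemma abs_mul_unit_norm_le (x : E.carrier) (i j : ℕ) :
    |(x : ℕ → ℝ) i| * E.norm (E.unit j) ≤ E.norm x := by
  set r := |(x : ℕ → ℝ) i| with hr
  have hr0 : 0 ≤ r := abs_nonneg _
  have hle : ∀ k, |(Pi.single j r : ℕ → ℝ) k| ≤ r := fun k => by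
    by_cases h : k = j
    · subst h
      simp [abs_of_nonneg hr0]
    · simp [h, hr0]
  have hcount : ∀ c : ℝ, 0 ≤ c → {k | c < |(Pi.single j r : ℕ → ℝ) k|}.encard
      ≤ {k | c < |(x : ℕ → ℝ) k|}.encard := by
    intro c hc
    by_cases hcr : c < r
    · calc _ ≤ ({j} : Set ℕ).encard := Set.encard_le_encard fun k hk => by
            by_contra h
            simp only [Set.mem_singleton_iff] at h
            simp [h] at hk
            exact absurd hk (not_lt.mpr hc)
        _ = ({i} : Set ℕ).encard := by simp
        _ ≤ _ := Set.encard_le_encard fun k hk => by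
            rw [Set.mem_singleton_iff.mp hk]
            exact hcr
    · have : {k | c < |(Pi.single j r : ℕ → ℝ) k|} = ∅ := by
        ext k
        simpa using (hle k).trans (not_lt.mp hcr)
      simp [this]
  obtain ⟨hy, hnorm⟩ := E.symmetric x (Pi.single j r) ⟨r, by rintro _ ⟨k, rfl⟩; exact hle k⟩
    (rearrangement_le_of_encard_le (E.bounded x x.2) hcount)
  have h1 : (⟨Pi.single j r, hy⟩ : E.carrier) = r • E.unit j := by
    ext k
    by_cases h : k = j
    · subst h
      simp [unit]
    · simp [unit, h]
  rwa [h1, map_smul_eq_mul, Real.norm_of_nonneg hr0] at hnorm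

lemma unit_norm_le (i j : ℕ) : E.norm (E.unit i) ≤ E.norm (E.unit j) := by
  have := E.abs_mul_unit_norm_le (E.unit j) j i
  simpa [unit] using this

/-- The inclusion of `ℓ¹` in a symmetric sequence space is continuous. -/
lemma norm_le_unit_norm_mul_tsum (x : E.carrier) (hx : Summable fun i => |(x : ℕ → ℝ) i|) :
    E.norm x ≤ E.norm (E.unit 0) * ∑' i, |(x : ℕ → ℝ) i| := by
  set κ := E.norm (E.unit 0) with hκ
  have hκ0 : 0 < κ := E.unit_norm_pos 0
  set u : ℕ → E.carrier := fun n => ∑ i ∈ Finset.range n, (x : ℕ → ℝ) i • E.unit i with hu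
  have hsum : ∀ A : Finset ℕ, E.norm (∑ i ∈ A, (x : ℕ → ℝ) i • E.unit i)
      ≤ κ * ∑ i ∈ A, |(x : ℕ → ℝ) i| := by
    intro A
    refine (Finset.le_sum_of_subadditive E.norm (map_zero _).le (map_add_le_add _) A _).trans ?_
    rw [Finset.mul_sum]
    refine Finset.sum_le_sum fun i _ => ?_
    rw [map_smul_eq_mul, Real.norm_eq_abs, mul_comm]
    exact mul_le_mul_of_nonneg_right (E.unit_norm_le i 0) (abs_nonneg _)
  have hcoord : ∀ i n, i < n → (u n : ℕ → ℝ) i = (x : ℕ → ℝ) i := by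
    intro i n hin
    simp only [hu, Submodule.coe_sum, Finset.sum_apply, Submodule.coe_smul, Pi.smul_apply, unit]
    rw [Finset.sum_eq_single i]
    · simp
    · intro k _ hk
      simp [hk.symm]
    · intro h
      exact absurd (Finset.mem_range.mpr hin) h
  have hcauchy : ∀ ε : ℝ, 0 < ε → ∃ N : ℕ, ∀ m ≥ N, ∀ n ≥ N, E.norm (u m - u n) < ε := by
    intro ε hε
    have h1 := hx.hasSum.tendsto_sum_nat
    obtain ⟨N, hN⟩ := Metric.tendsto_atTop.mp h1 (ε / (2 * κ)) (by positivity)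
    have h2 : ∀ n ≥ N, E.norm (u n - u N) < ε / 2 := by
      intro n hn
      have h3 : u n - u N = ∑ i ∈ Finset.Ico N n, (x : ℕ → ℝ) i • E.unit i :=
        (Finset.sum_Ico_eq_sub _ hn).symm
      have h4 : ∑ i ∈ Finset.Ico N n, |(x : ℕ → ℝ) i| < ε / (2 * κ) := by
        rw [Finset.sum_Ico_eq_sub _ hn]
        have h5 := hN N le_rfl
        rw [Real.dist_eq, abs_lt] at h5
        have h6 := hx.sum_le_tsum (Finset.range n) fun i _ => abs_nonneg _
        linarith
      rw [h3]
      refine (hsum _).trans_lt ?_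
      calc _ < κ * (ε / (2 * κ)) := mul_lt_mul_of_pos_left h4 hκ0
        _ = ε / 2 := by field_simp
    refine ⟨N, fun m hm n hn => ?_⟩
    have h3 : u m - u n = (u m - u N) - (u n - u N) := by abel
    rw [h3]
    have := map_sub_le_add E.norm (u m - u N) (u n - u N)
    linarith [h2 m hm, h2 n hn]
  obtain ⟨z, hz⟩ := E.complete u hcauchy
  have hzx : z = x := by
    ext i
    have h1 : ∀ᶠ n in atTop, |(x : ℕ → ℝ) i - (z : ℕ → ℝ) i| * κ ≤ E.norm (u n - z) := by
      filter_upwards [eventually_gt_atTop i] with n hn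
      have := E.abs_mul_unit_norm_le (u n - z) i 0
      rwa [Submodule.coe_sub, Pi.sub_apply, hcoord i n hn] at this
    have h2 := ge_of_tendsto hz h1
    have h3 : |(x : ℕ → ℝ) i - (z : ℕ → ℝ) i| = 0 :=
      le_antisymm (nonpos_of_mul_nonpos_left h2 hκ0) (abs_nonneg _)
    linarith [abs_eq_zero.mp h3]
  rw [hzx] at hz
  have h1 : ∀ n, E.norm x ≤ κ * ∑' i, |(x : ℕ → ℝ) i| + E.norm (u n - x) := by
    intro n
    have h2 : x = u n - (u n - x) := by abel
    have h3 := map_sub_le_add E.norm (u n) (u n - x)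
    rw [← h2] at h3
    have h4 := (hsum (Finset.range n)).trans (mul_le_mul_of_nonneg_left
      (hx.sum_le_tsum (Finset.range n) fun i _ => abs_nonneg _) hκ0.le)
    linarith
  have h5 := ge_of_tendsto' (hz.const_add (κ * ∑' i, |(x : ℕ → ℝ) i|)) h1
  simpa using h5

end SymmetricSequenceSpace

lemma unit_norm_mul_norm_entry_le {E : SymmetricSequenceSpace} (y : schatten E) (i j : ℕ) :
    E.norm (E.unit 0) * ‖entry (y : Ell2 →L[ℂ] Ell2) i j‖ ≤ schattenNorm E y := by
  have h := E.abs_mul_unit_norm_le ⟨singularNumber (y : Ell2 →L[ℂ] Ell2), y.2⟩ 0 0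
  simp only [singularNumber_zero_eq_norm, abs_norm] at h
  rw [mul_comm]
  exact (mul_le_mul_of_nonneg_right (norm_entry_le _ i j) (E.unit_norm_pos 0).le).trans h

/-- The norm of every Schatten space is bounded, up to a constant, by the trace norm, here in its
dual description. -/
lemma schattenNorm_le_of_pair_le {E : SymmetricSequenceSpace} (y : schatten E) {B : ℝ}
    (hy : ∀ s W, IsContraction s W → ‖pair s W (entry (y : Ell2 →L[ℂ] Ell2))‖ ≤ B) :
    schattenNorm E y ≤ E.norm (E.unit 0) * (4 * B) := by
  obtain ⟨hs, hle⟩ := summable_singularNumber_of_pair_le hy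
  have habs : ∀ n, |singularNumber (y : Ell2 →L[ℂ] Ell2) n| = singularNumber y n :=
    fun n => abs_of_nonneg (singularNumber_nonneg _ n)
  refine (E.norm_le_unit_norm_mul_tsum ⟨singularNumber (y : Ell2 →L[ℂ] Ell2), y.2⟩ ?_).trans ?_
  · simpa only [habs] using hs
  · simp only [habs]
    exact mul_le_mul_of_nonneg_left hle (E.unit_norm_pos 0).le

/-! ### Weakly null sequences in the trace class -/

lemma IsWeaklyNull.tendsto_inner {u : ℕ → traceClass} (hu : IsWeaklyNull u) (v w : Ell2) :
    Tendsto (fun n => ⟪v, (u n : Ell2 →L[ℂ] Ell2) w⟫_ℂ) atTop (𝓝 0) := by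
  refine hu
    { toFun := fun x => ⟪v, (x : Ell2 →L[ℂ] Ell2) w⟫_ℂ
      map_add' := fun x y => by simp
      map_smul' := fun c x => by simp } ⟨‖v‖ * ‖w‖, fun x => ?_⟩
  calc ‖⟪v, (x : Ell2 →L[ℂ] Ell2) w⟫_ℂ‖ ≤ ‖v‖ * (‖(x : Ell2 →L[ℂ] Ell2)‖ * ‖w‖) :=
        (norm_inner_le_norm _ _).trans
          (mul_le_mul_of_nonneg_left (ContinuousLinearMap.le_opNorm _ _) (norm_nonneg _))
    _ ≤ ‖v‖ * (traceNorm x * ‖w‖) := by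
        gcongr
        exact norm_le_traceNorm x
    _ = ‖v‖ * ‖w‖ * traceNorm x := by ring

lemma IsWeaklyNull.tendsto_entry {u : ℕ → traceClass} (hu : IsWeaklyNull u) (i j : ℕ) :
    Tendsto (fun n => entry (u n : Ell2 →L[ℂ] Ell2) i j) atTop (𝓝 0) := by
  have := hu.tendsto_inner (lp.single 2 i (1 : ℂ)) (lp.single 2 j (1 : ℂ))
  simp only [inner_single_one_left] at this
  exact this

/-- Multiplication by a null sequence is a compact operator on `ℓ²`: it maps weakly null sequences
to norm null ones. -/
lemma eventually_l2_mul_le {v : ℕ → Ell2} (hv : ∀ w, Tendsto (fun n => ⟪v n, w⟫_ℂ) atTop (𝓝 0))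
    {c : ℕ → ℂ} (hc : Tendsto c atTop (𝓝 0)) {ε : ℝ} (hε : 0 < ε) :
    ∀ᶠ n in atTop, ∀ s : Finset ℕ, l2 s (fun j => c j * v n j) ≤ ε := by
  obtain ⟨B, hB⟩ : ∃ B, ∀ n, ‖innerSL ℂ (v n)‖ ≤ B := banach_steinhaus fun w => by
    obtain ⟨C, hC⟩ := (hv w).norm.bddAbove_range
    exact ⟨C, fun n => hC ⟨n, rfl⟩⟩
  simp only [innerSL_apply_norm] at hB
  have hB0 : 0 ≤ B := (norm_nonneg _).trans (hB 0)
  set η := ε / (2 * (B + 1)) with hη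
  have hη0 : 0 < η := by positivity
  obtain ⟨N, hN⟩ := Metric.tendsto_atTop.mp hc η hη0
  have hhead : Tendsto (fun n => ∑ j ∈ Finset.range N, ‖c j * v n j‖ ^ 2) atTop (𝓝 0) := by
    have h1 : ∀ j, Tendsto (fun n => ‖c j * v n j‖ ^ 2) atTop (𝓝 0) := by
      intro j
      have h2 := (hv (lp.single 2 j (1 : ℂ))).norm
      have h3 : ∀ n, ‖⟪v n, (lp.single 2 j (1 : ℂ) : Ell2)⟫_ℂ‖ = ‖v n j‖ := fun n => by
        rw [norm_inner_symm, inner_single_one_left]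
      simp only [h3, norm_zero] at h2
      simpa [norm_mul] using (h2.const_mul ‖c j‖).pow 2
    simpa using tendsto_finsetSum (Finset.range N) fun j _ => h1 j
  filter_upwards [hhead.eventually (gt_mem_nhds (show 0 < ε ^ 2 / 2 by positivity))] with n hn s
  refine Real.sqrt_le_iff.mpr ⟨hε.le, ?_⟩
  have htail : ∑ j ∈ s, ‖v n j‖ ^ 2 ≤ B ^ 2 := by
    rw [← l2_sq]
    exact pow_le_pow_left₀ (l2_nonneg _ _) ((l2_coe_le_norm s (v n)).trans (hB n)) 2
  -- Large `j` are controlled by `c`, the finitely many others by weak convergence.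
  have hsplit : ∀ j ∈ s, ‖c j * v n j‖ ^ 2
      ≤ (if j ∈ Finset.range N then ‖c j * v n j‖ ^ 2 else 0) + η ^ 2 * ‖v n j‖ ^ 2 := by
    intro j _
    by_cases hj : j ∈ Finset.range N
    · rw [if_pos hj]
      exact le_add_of_nonneg_right (by positivity)
    · rw [if_neg hj, zero_add, norm_mul, mul_pow]
      have h1 := hN j (by simpa using hj)
      rw [dist_zero_right] at h1
      gcongr
  refine (Finset.sum_le_sum hsplit).trans ?_
  rw [Finset.sum_add_distrib, ← Finset.mul_sum, ← Finset.sum_filter]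
  have h1 : ∑ j ∈ s with j ∈ Finset.range N, ‖c j * v n j‖ ^ 2
      ≤ ∑ j ∈ Finset.range N, ‖c j * v n j‖ ^ 2 :=
    Finset.sum_le_sum_of_subset_of_nonneg (fun j hj => (Finset.mem_filter.mp hj).2)
      fun _ _ _ => sq_nonneg _
  have h2 : η ^ 2 * ∑ j ∈ s, ‖v n j‖ ^ 2 ≤ ε ^ 2 / 4 := by
    calc _ ≤ η ^ 2 * (B + 1) ^ 2 := by
          gcongr
          exact htail.trans (pow_le_pow_left₀ hB0 (by linarith) 2)
      _ = ε ^ 2 / 4 := by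
          rw [hη]
          field_simp
          norm_num
  nlinarith [sq_nonneg ε]

/-- The part of the matrix `X` with both indices at least `m` pairs with contractions to at most
`ε`; up to a constant, its trace norm is at most `ε`. -/
def TailLE (m : ℕ) (ε : ℝ) (X : ℕ → ℕ → ℂ) : Prop :=
  ∀ s W, (∀ i ∈ s, m ≤ i) → IsContraction s W → ‖pair s W X‖ ≤ ε

lemma pairwise_disjoint_of_strictMono {m : ℕ → ℕ} (hm : StrictMono m) {s : ℕ → Finset ℕ}
    (hs : ∀ k, ∀ i ∈ s k, m k ≤ i ∧ i < m (k + 1)) (A : Set ℕ) : A.PairwiseDisjoint s := by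
  have key : ∀ j k, j < k → Disjoint (s j) (s k) := by
    intro j k hjk
    rw [Finset.disjoint_left]
    intro i hi hi'
    have h1 := (hs j i hi).2
    have h2 := (hs k i hi').1
    have h3 : m (j + 1) ≤ m k := hm.monotone hjk
    omega
  intro j _ k _ hjk
  rcases lt_or_gt_of_ne hjk with h | h
  · exact key j k h
  · exact (key k j h).symm

lemma sum_norm_pair_le {s : ℕ → Finset ℕ} {W : ℕ → ℕ → ℕ → ℂ}
    (hW : ∀ k, IsContraction (s k) (W k)) (hs : ∀ A : Set ℕ, A.PairwiseDisjoint s)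
    {X : ℕ → ℕ → ℂ} (A : Finset ℕ) {C : ℝ}
    (hC : ∀ U, IsContraction (A.biUnion s) U → ‖pair (A.biUnion s) U X‖ ≤ C) :
    ∑ k ∈ A, ‖pair (s k) (W k) X‖ ≤ C := by
  obtain ⟨U, hU, hUX⟩ := exists_contraction_sum_norm hW A (hs A) X
  have h := hC U hU
  rw [hUX, Complex.norm_real] at h
  exact (le_abs_self _).trans h

/-- For a single trace class operator the corners tend to zero: otherwise arbitrarily many
contractions on disjoint blocks, each pairing to more than `ε`, add up to a contraction whose
pairing exceeds the bound by the trace norm. -/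
lemma exists_tailLE {x : Ell2 →L[ℂ] Ell2} (hx : Summable (singularNumber x)) {ε : ℝ}
    (hε : 0 < ε) : ∃ m, TailLE m ε (entry x) := by
  by_contra hnot
  simp only [TailLE] at hnot
  push Not at hnot
  choose S W hS hW hp using hnot
  -- Start each block beyond the previous one.
  set g : ℕ → ℕ := fun m => max (m + 1) ((S m).sup id + 1) with hg
  set m : ℕ → ℕ := fun k => g^[k] 0 with hm
  have hsucc : ∀ k, m (k + 1) = g (m k) := fun k => Function.iterate_succ_apply' g k 0
  have hmono : StrictMono m := strictMono_nat_of_lt_succ fun k => by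
    rw [hsucc]
    exact lt_of_lt_of_le (Nat.lt_succ_self _) (le_max_left _ _)
  have hdisj := pairwise_disjoint_of_strictMono hmono (s := fun k => S (m k)) fun k i hi => by
    refine ⟨hS (m k) i hi, ?_⟩
    rw [hsucc]
    have h1 : i ≤ (S (m k)).sup id := Finset.le_sup (f := id) hi
    exact lt_of_lt_of_le (Nat.lt_succ_of_le h1) (le_max_right _ _)
  obtain ⟨K, hK⟩ := exists_nat_gt (13 * (∑' n, singularNumber x n) / ε)
  have h1 := sum_norm_pair_le (fun k => hW (m k)) hdisj (X := entry x) (Finset.range K)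
    fun U hU => hU.norm_pair_entry_le hx
  have h2 := Finset.card_nsmul_le_sum (Finset.range K)
    (fun k => ‖pair (S (m k)) (W (m k)) (entry x)‖) ε fun k _ => (hp (m k)).le
  rw [Finset.card_range, nsmul_eq_mul] at h2
  rw [div_lt_iff₀ hε] at hK
  linarith

/-- The functional `x ↦ ∑ₖ ∑_{i,j} (W_k)_{ij} x_{ij}` given by contractions on disjoint blocks is
bounded on the trace class. -/
lemma exists_blockFunctional {s : ℕ → Finset ℕ} {W : ℕ → ℕ → ℕ → ℂ}
    (hW : ∀ k, IsContraction (s k) (W k)) (hs : ∀ A : Set ℕ, A.PairwiseDisjoint s) :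
    (∀ x : traceClass, Summable fun k => ‖pair (s k) (W k) (entry (x : Ell2 →L[ℂ] Ell2))‖) ∧
    ∃ f : traceClass →ₗ[ℂ] ℂ, (∀ x, f x = ∑' k, pair (s k) (W k) (entry (x : Ell2 →L[ℂ] Ell2))) ∧
      ∀ x, ‖f x‖ ≤ 13 * traceNorm x := by
  have hle : ∀ (x : traceClass) (A : Finset ℕ),
      ∑ k ∈ A, ‖pair (s k) (W k) (entry (x : Ell2 →L[ℂ] Ell2))‖ ≤ 13 * traceNorm x :=
    fun x A => sum_norm_pair_le hW hs A fun U hU => hU.norm_pair_entry_le x.2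
  have hsum : ∀ x : traceClass,
      Summable fun k => ‖pair (s k) (W k) (entry (x : Ell2 →L[ℂ] Ell2))‖ :=
    fun x => summable_of_sum_le (fun _ => norm_nonneg _) (hle x)
  refine ⟨hsum, { toFun := fun x => ∑' k, pair (s k) (W k) (entry (x : Ell2 →L[ℂ] Ell2))
                  map_add' := fun x y => ?_
                  map_smul' := fun c x => ?_ }, fun _ => rfl, fun x => ?_⟩
  · rw [← (hsum x).of_norm.tsum_add (hsum y).of_norm]
    simp only [Submodule.coe_add, entry_add, pair_add_right]
  · simp only [Submodule.coe_smul, entry_smul, pair_smul_right, RingHom.id_apply, smul_eq_mul]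
    exact tsum_mul_left
  · exact (norm_tsum_le_tsum_norm (hsum x)).trans
      ((hsum x).tsum_le_of_sum_le (hle x))

/-- The finite upper left corners of a weakly null sequence tend to zero. -/
lemma IsWeaklyNull.exists_head_le {u : ℕ → traceClass} (hu : IsWeaklyNull u) (m : ℕ) {ε : ℝ}
    (hε : 0 < ε) : ∃ n₀, ∀ n ≥ n₀, ∀ s W, (∀ i ∈ s, i < m) → IsContraction s W →
      ‖pair s W (entry (u n : Ell2 →L[ℂ] Ell2))‖ ≤ ε := by
  have hlim : Tendsto (fun n => ∑ i ∈ Finset.range m, ∑ j ∈ Finset.range m,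
      ‖entry (u n : Ell2 →L[ℂ] Ell2) i j‖) atTop (𝓝 0) := by
    have := tendsto_finsetSum (Finset.range m) fun i _ =>
      tendsto_finsetSum (Finset.range m) fun j _ => (hu.tendsto_entry i j).norm
    simpa using this
  obtain ⟨n₀, hn₀⟩ := eventually_atTop.mp (hlim.eventually (gt_mem_nhds hε))
  refine ⟨n₀, fun n hn s W hs hW => le_trans ?_ (hn₀ n hn).le⟩
  have hsub : s ⊆ Finset.range m := fun i hi => Finset.mem_range.mpr (hs i hi)
  calc _ ≤ ∑ i ∈ s, ∑ j ∈ s, ‖entry (u n : Ell2 →L[ℂ] Ell2) i j‖ :=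
        norm_sum_le_of_le _ fun i hi => norm_sum_le_of_le _ fun j hj => by
          rw [norm_mul]
          exact mul_le_of_le_one_left (norm_nonneg _) (hW.norm_le_one hi hj)
    _ ≤ ∑ i ∈ s, ∑ j ∈ Finset.range m, ‖entry (u n : Ell2 →L[ℂ] Ell2) i j‖ :=
        Finset.sum_le_sum fun i _ =>
          Finset.sum_le_sum_of_subset_of_nonneg hsub fun _ _ _ => norm_nonneg _
    _ ≤ _ := Finset.sum_le_sum_of_subset_of_nonneg hsub fun _ _ _ =>
        Finset.sum_nonneg fun _ _ => norm_nonneg _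

/-- The lower right corners of a weakly null sequence in the trace class are small for large `n`. A
gliding hump: otherwise there are contractions `W_k` on consecutive blocks and terms `u_{n_k}` whose
pairing with `W_k` exceeds `ε`, while the pairings of `u_{n_k}` with all other `W_j` add up to at
most `ε / 2`; then the functional given by all the `W_k` together does not tend to zero along
`u`. -/
lemma IsWeaklyNull.exists_tailLE {u : ℕ → traceClass} (hu : IsWeaklyNull u) {ε : ℝ} (hε : 0 < ε) :
    ∃ m n₀, ∀ n ≥ n₀, TailLE m ε (entry (u n : Ell2 →L[ℂ] Ell2)) := by
  by_contra hnot
  push Not at hnot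
  choose h hh using fun m => hu.exists_head_le m (show 0 < ε / 4 by positivity)
  have hstep : ∀ m, ∃ n, ∃ s : Finset ℕ, ∃ W, ∃ m', max m (h m) ≤ n ∧ (∀ i ∈ s, m ≤ i) ∧
      IsContraction s W ∧ ε < ‖pair s W (entry (u n : Ell2 →L[ℂ] Ell2))‖ ∧ m < m' ∧
      (∀ i ∈ s, i < m') ∧ TailLE m' (ε / 4) (entry (u n : Ell2 →L[ℂ] Ell2)) := by
    intro m
    obtain ⟨n, hn, htail⟩ := hnot m (max m (h m))
    simp only [TailLE] at htail
    push Not at htail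
    obtain ⟨s, W, hs, hW, hp⟩ := htail
    obtain ⟨t, ht⟩ := SchurDP.exists_tailLE (u n).2 (show 0 < ε / 4 by positivity)
    refine ⟨n, s, W, max (m + 1) (max (s.sup id + 1) t), hn, hs, hW, hp, by omega, ?_, ?_⟩
    · intro i hi
      have : i ≤ s.sup id := Finset.le_sup (f := id) hi
      omega
    · intro r V hr hV
      exact ht r V (fun i hi => le_trans (by omega) (hr i hi)) hV
  choose n S W g hn hS hW hp hg hSg htail using hstep
  set m : ℕ → ℕ := fun k => g^[k] 0 with hm
  have hsucc : ∀ k, m (k + 1) = g (m k) := fun k => Function.iterate_succ_apply' g k 0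
  have hmono : StrictMono m := strictMono_nat_of_lt_succ fun k => by
    rw [hsucc]
    exact hg _
  have hblock : ∀ k, ∀ i ∈ S (m k), m k ≤ i ∧ i < m (k + 1) := fun k i hi =>
    ⟨hS _ i hi, by rw [hsucc]; exact hSg _ i hi⟩
  have hdisj := pairwise_disjoint_of_strictMono hmono (s := fun k => S (m k)) hblock
  obtain ⟨hsum, f, hf, hfC⟩ := exists_blockFunctional (fun k => hW (m k)) hdisj
  have hlim : Tendsto (fun k => f (u (n (m k)))) atTop (𝓝 0) := by
    refine (hu f ⟨13, hfC⟩).comp (tendsto_atTop_mono (fun k => ?_) tendsto_id)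
    have h1 := hn (m k)
    have h2 := hmono.le_apply (x := k)
    simp only [id]
    omega
  obtain ⟨k, hk⟩ := (hlim.norm.eventually (gt_mem_nhds (show ‖(0 : ℂ)‖ < ε / 2 by
    simpa using by positivity))).exists
  set X := entry (u (n (m k)) : Ell2 →L[ℂ] Ell2) with hX
  have hoff : ∀ A : Finset ℕ,
      ∑ j ∈ A, ‖if j = k then 0 else pair (S (m j)) (W (m j)) X‖ ≤ ε / 2 := by
    intro A
    have hlow : ∑ j ∈ A with j < k, ‖pair (S (m j)) (W (m j)) X‖ ≤ ε / 4 := by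
      refine sum_norm_pair_le (fun k => hW (m k)) hdisj _ fun U hU => ?_
      refine hh (m k) _ ((le_max_right _ _).trans (hn (m k))) _ _ (fun i hi => ?_) hU
      obtain ⟨j, hj, hij⟩ := Finset.mem_biUnion.mp hi
      have h1 : m (j + 1) ≤ m k := hmono.monotone (Finset.mem_filter.mp hj).2
      exact (hblock j i hij).2.trans_le h1
    have hhigh : ∑ j ∈ A with k < j, ‖pair (S (m j)) (W (m j)) X‖ ≤ ε / 4 := by
      refine sum_norm_pair_le (fun k => hW (m k)) hdisj _ fun U hU => ?_
      refine htail (m k) _ _ (fun i hi => ?_) hU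
      obtain ⟨j, hj, hij⟩ := Finset.mem_biUnion.mp hi
      have h1 : m (k + 1) ≤ m j := hmono.monotone (Finset.mem_filter.mp hj).2
      rw [← hsucc]
      exact h1.trans (hblock j i hij).1
    have hle : ∑ j ∈ A, ‖if j = k then 0 else pair (S (m j)) (W (m j)) X‖
        = ∑ j ∈ A with j < k, ‖pair (S (m j)) (W (m j)) X‖
          + ∑ j ∈ A with k < j, ‖pair (S (m j)) (W (m j)) X‖ := by
      rw [Finset.sum_filter, Finset.sum_filter, ← Finset.sum_add_distrib]
      refine Finset.sum_congr rfl fun j _ => ?_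
      rcases lt_trichotomy j k with hjk | hjk | hjk
      · simp [hjk, hjk.ne, hjk.le]
      · simp [hjk]
      · simp [hjk, hjk.ne', hjk.le]
    linarith
  have hsumX : Summable fun j => pair (S (m j)) (W (m j)) X := (hsum (u (n (m k)))).of_norm
  have hoff' : ‖∑' j, if j = k then 0 else pair (S (m j)) (W (m j)) X‖ ≤ ε / 2 :=
    (norm_tsum_le_tsum_norm (summable_of_sum_le (fun _ => norm_nonneg _) hoff)).trans
      ((summable_of_sum_le (fun _ => norm_nonneg _) hoff).tsum_le_of_sum_le hoff)
  rw [hf, hsumX.tsum_eq_add_tsum_ite k] at hk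
  have h1 := norm_sub_le_norm_add (pair (S (m k)) (W (m k)) X)
    (∑' j, if j = k then 0 else pair (S (m j)) (W (m j)) X)
  have h2 := hp (m k)
  linarith

/-! ### Symbols of positive and of Dunford–Pettis Schur multipliers -/

section SchurMultiplier

variable {E : SymmetricSequenceSpace} {T : traceClass →ₗ[ℂ] schatten E} {φ : ℕ → ℕ → ℂ}

lemma IsSchurMultiplier.entry_traceRankOne (hT : IsSchurMultiplier T φ) (a b : Ell2) (i j : ℕ) :
    entry (T (traceRankOne a b)) i j = φ i j * (a i * star (b j)) := by
  rw [hT, ← entry_rankOne]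
  rfl

lemma trunc_apply_of_mem {s : Finset ℕ} {i : ℕ} (hi : i ∈ s) (a : ℕ → ℂ) : trunc s a i = a i := by
  rw [← inner_single_one_left, ← inner_conj_symm, inner_trunc_left]
  simp [lp.single_apply, Pi.single_apply, hi]

/-- The symbol of a positive Schur multiplier is positive semidefinite, as the multiplier maps the
rank-one operator with all entries `1` on `s × s` to the section of its symbol on `s`. -/
lemma IsPositiveMap.isPosSemidefKernel (hT : IsSchurMultiplier T φ) (hpos : IsPositiveMap T) :
    IsPosSemidefKernel φ := by
  have hA : ∀ s : Finset ℕ, ∃ A : Ell2 →L[ℂ] Ell2, A.IsPositive ∧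
      ∀ i ∈ s, ∀ j ∈ s, entry A i j = φ i j := by
    intro s
    refine ⟨T (traceRankOne (trunc s 1) (trunc s 1)),
      hpos _ (InnerProductSpace.isPositive_rankOne_self _), fun i hi j hj => ?_⟩
    rw [hT.entry_traceRankOne, trunc_apply_of_mem hi, trunc_apply_of_mem hj]
    simp
  refine ⟨fun i j => ?_, fun s w => ?_⟩
  · obtain ⟨A, hpA, hAφ⟩ := hA {i, j}
    rw [← hAφ i (by simp) j (by simp), ← hAφ j (by simp) i (by simp)]
    have h1 := hpA.inner_left_eq_inner_right (lp.single 2 j (1 : ℂ)) (lp.single 2 i (1 : ℂ))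
    rw [inner_single_one_left, ← inner_conj_symm, inner_single_one_left] at h1
    exact h1.symm
  · obtain ⟨A, hpA, hAφ⟩ := hA s
    have h1 := hpA.inner_nonneg_right (trunc s w)
    rw [inner_trunc_map_trunc] at h1
    convert h1 using 1
    refine Finset.sum_congr rfl fun i hi => Finset.sum_congr rfl fun j hj => ?_
    rw [hAφ i hi j hj]
    ring

/-- The rank-one operators `a ⊗ e_n` tend weakly to zero in the trace class: bounded functionals
restrict to bounded antilinear functionals of the second factor. -/
lemma isWeaklyNull_traceRankOne_single (a : Ell2) :
    IsWeaklyNull fun n => traceRankOne a (lp.single 2 n (1 : ℂ)) := by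
  rintro f ⟨C, hC⟩
  set g : Ell2 →L[ℂ] ℂ := LinearMap.mkContinuous
    { toFun := fun b => star (f (traceRankOne a b))
      map_add' := fun b c => by
        have h : traceRankOne a (b + c) = traceRankOne a b + traceRankOne a c :=
          Subtype.ext (map_add _ _ _)
        rw [h, map_add, star_add]
      map_smul' := fun r b => by
        have h : traceRankOne a (r • b) = star r • traceRankOne a b :=
          Subtype.ext (LinearMap.map_smulₛₗ _ _ _)
        rw [h, map_smul, smul_eq_mul, star_mul, star_star, mul_comm]
        rfl } (C * ‖a‖) (fun b => by
      change ‖star (f (traceRankOne a b))‖ ≤ _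
      rw [norm_star, mul_assoc, ← traceNorm_traceRankOne]
      exact hC _) with hg
  obtain ⟨w, hw⟩ := (InnerProductSpace.toDual ℂ Ell2).surjective g
  have h1 : ∀ n, ‖f (traceRankOne a (lp.single 2 n (1 : ℂ)))‖ = ‖w n‖ := by
    intro n
    rw [← norm_star]
    change ‖g (lp.single 2 n (1 : ℂ))‖ = _
    rw [← hw, InnerProductSpace.toDual_apply_apply, norm_inner_symm, inner_single_one_left]
  have h2 : Tendsto (fun n => ‖w n‖) atTop (𝓝 0) := by
    have h3 := (lp.hasSum_single (by norm_num) w).summable.tendsto_atTop_zero.norm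
    have h4 : ∀ n, ‖(lp.single 2 n (w n) : Ell2)‖ = ‖w n‖ := fun n =>
      lp.norm_single (by norm_num) _ _
    simpa only [h4, norm_zero] using h3
  rw [tendsto_zero_iff_norm_tendsto_zero]
  simpa only [h1] using h2

lemma IsDunfordPettis.tendsto_row (hT : IsSchurMultiplier T φ) (hDP : IsDunfordPettis T) (i : ℕ) :
    Tendsto (fun n => φ i n) atTop (𝓝 0) := by
  have h1 := hDP _ (isWeaklyNull_traceRankOne_single (lp.single 2 i (1 : ℂ)))
  have hκ := E.unit_norm_pos 0
  have h2 : ∀ n, ‖φ i n‖ ≤ (E.norm (E.unit 0))⁻¹ *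
      schattenNorm E (T (traceRankOne (lp.single 2 i (1 : ℂ)) (lp.single 2 n (1 : ℂ)))) := by
    intro n
    have h3 := unit_norm_mul_norm_entry_le
      (T (traceRankOne (lp.single 2 i (1 : ℂ)) (lp.single 2 n (1 : ℂ)))) i n
    rw [hT.entry_traceRankOne] at h3
    simp only [lp.single_apply_self, star_one, mul_one] at h3
    rwa [le_inv_mul_iff₀ hκ]
  refine squeeze_zero_norm h2 ?_
  simpa using h1.const_mul (E.norm (E.unit 0))⁻¹

/-- The diagonal of the symbol of a Dunford–Pettis Schur multiplier is bounded: otherwise the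
multiplier maps a norm null sequence of multiples of diagonal matrix units to matrix units. -/
lemma IsDunfordPettis.exists_diag_le (hT : IsSchurMultiplier T φ) (hDP : IsDunfordPettis T) :
    ∃ M, ∀ i, ‖φ i i‖ ≤ M := by
  by_contra hnot
  push Not at hnot
  choose i hi using fun k : ℕ => hnot (k + 1)
  have hne : ∀ k, φ (i k) (i k) ≠ 0 := fun k h => by
    have := hi k
    rw [h, norm_zero] at this
    linarith [(Nat.cast_nonneg k : (0 : ℝ) ≤ k)]
  set u : ℕ → traceClass := fun k =>
    traceRankOne ((φ (i k) (i k))⁻¹ • lp.single 2 (i k) (1 : ℂ)) (lp.single 2 (i k) (1 : ℂ)) with hu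
  have hnorm : Tendsto (fun k => traceNorm (u k)) atTop (𝓝 0) := by
    refine squeeze_zero (fun k => ?_) (fun k => ?_) tendsto_one_div_add_atTop_nhds_zero_nat
    · rw [hu, traceNorm_traceRankOne]
      positivity
    · rw [hu, traceNorm_traceRankOne, norm_smul, norm_single_one, norm_inv, mul_one, mul_one,
        ← one_div]
      exact one_div_le_one_div_of_le (by positivity) (hi k).le
  have hweak : IsWeaklyNull u := by
    rintro f ⟨C, hC⟩
    refine squeeze_zero_norm (fun k => hC (u k)) ?_
    simpa using hnorm.const_mul C
  have hlow : ∀ k, E.norm (E.unit 0) ≤ schattenNorm E (T (u k)) := by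
    intro k
    have h3 := unit_norm_mul_norm_entry_le (T (u k)) (i k) (i k)
    rw [hu, hT.entry_traceRankOne] at h3
    simp only [lp.coeFn_smul, Pi.smul_apply, lp.single_apply_self, star_one, mul_one,
      smul_eq_mul] at h3
    rwa [mul_inv_cancel₀ (hne k), norm_one, mul_one] at h3
  have := ge_of_tendsto' (hDP u hweak) hlow
  linarith [E.unit_norm_pos 0]

/-- A Schur multiplier with positive semidefinite symbol, bounded diagonal and null rows is
Dunford–Pettis. Up to its first `m` rows and columns, a weakly null sequence is uniformly small in
trace norm, and so is its image by Schur's inequality; on a single row or column the multiplier is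
a compact diagonal operator on `ℓ²`. -/
lemma IsPosSemidefKernel.isDunfordPettis (hT : IsSchurMultiplier T φ) (hφ : IsPosSemidefKernel φ)
    {M : ℝ} (hM : ∀ i, ‖φ i i‖ ≤ M) (hrow : ∀ i, Tendsto (fun j => φ i j) atTop (𝓝 0)) :
    IsDunfordPettis T := by
  intro u hu
  set κ := E.norm (E.unit 0) with hκ
  have hκ0 : 0 < κ := E.unit_norm_pos 0
  have hM0 : 0 ≤ M := (norm_nonneg _).trans (hM 0)
  set X : ℕ → ℕ → ℕ → ℂ := fun n => entry (u n : Ell2 →L[ℂ] Ell2) with hX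
  have hTX : ∀ n, entry (T (u n)) = fun i j => φ i j * X n i j := fun n => by
    funext i j
    exact hT (u n) i j
  have hcol : ∀ j, Tendsto (fun i => φ i j) atTop (𝓝 0) := fun j => by
    have h1 : ∀ i, φ i j = star (φ j i) := fun i => hφ.1 j i
    simp only [h1]
    simpa using (hrow j).star
  have hpair : ∀ ε : ℝ, 0 < ε → ∀ᶠ n in atTop, ∀ s W, IsContraction s W →
      ‖pair s W (entry (T (u n)))‖ ≤ (M + 3) * ε := by
    intro ε hε
    obtain ⟨m, n₀, htail⟩ := hu.exists_tailLE hε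
    have hδ : 0 < ε / (m + 1) := by positivity
    have hrows : ∀ᶠ n in atTop, ∀ i ∈ Finset.range m, ∀ s : Finset ℕ,
        l2 s (fun j => φ i j * X n i j) ≤ ε / (m + 1) := by
      rw [Filter.eventually_all_finset]
      intro i _
      have h1 : ∀ w, Tendsto (fun n => ⟪(u n : Ell2 →L[ℂ] Ell2).adjoint
          (lp.single 2 i (1 : ℂ)), w⟫_ℂ) atTop (𝓝 0) := fun w => by
        simpa only [ContinuousLinearMap.adjoint_inner_left] using
          hu.tendsto_inner (lp.single 2 i (1 : ℂ)) w
      filter_upwards [eventually_l2_mul_le h1 (hrow i) hδ] with n hn s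
      refine le_of_eq_of_le ?_ (hn s)
      have h2 : ∀ j, ‖X n i j‖
          = ‖(u n : Ell2 →L[ℂ] Ell2).adjoint (lp.single 2 i (1 : ℂ)) j‖ := fun j => by
        rw [← inner_single_one_left, ContinuousLinearMap.adjoint_inner_right, norm_inner_symm,
          inner_single_one_left]
        rfl
      simp only [l2, norm_mul, h2]
    have hcols : ∀ᶠ n in atTop, ∀ j ∈ Finset.range m, ∀ s : Finset ℕ,
        l2 s (fun i => φ i j * X n i j) ≤ ε / (m + 1) := by
      rw [Filter.eventually_all_finset]
      intro j _
      have h1 : ∀ w, Tendsto (fun n => ⟪(u n : Ell2 →L[ℂ] Ell2) (lp.single 2 j (1 : ℂ)), w⟫_ℂ)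
          atTop (𝓝 0) := fun w => by
        have h2 := (hu.tendsto_inner w (lp.single 2 j (1 : ℂ))).star
        simpa using h2
      exact eventually_l2_mul_le h1 (hcol j) hδ
    filter_upwards [hrows, hcols, eventually_ge_atTop n₀] with n hr hc hn s W hW
    rw [hTX]
    set Y : ℕ → ℕ → ℂ := fun i j => φ i j * X n i j with hY
    set t := s.filter (m ≤ ·) with ht
    have hts : t ⊆ s := Finset.filter_subset _ _
    have hcorner : ‖pair t W Y‖ ≤ (M + 1) * ε := by
      have h1 := htail n hn t _ (fun i hi => (Finset.mem_filter.mp hi).2)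
        -- `M + 1` instead of `M`, which may be zero.
        (hφ.isContraction_mul (M := M + 1) (by linarith) (fun i => (hM i).trans (by linarith))
          (hW.mono hts))
      rw [pair_smul_left, norm_mul, norm_inv, Complex.norm_real,
        Real.norm_of_nonneg (by linarith), inv_mul_le_iff₀ (by linarith)] at h1
      refine le_of_eq_of_le (congrArg norm (pair_congr fun i _ j _ => ?_)) h1
      rw [hY]
      ring
    have hlow : ∀ i ∈ s.filter (¬ m ≤ ·), i ∈ s ∧ i ∈ Finset.range m := fun i hi => by
      rw [Finset.mem_filter] at hi
      exact ⟨hi.1, Finset.mem_range.mpr (not_le.mp hi.2)⟩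
    have hcard : ((s.filter (¬ m ≤ ·)).card : ℝ) * (ε / (m + 1)) ≤ ε := by
      have h1 : (s.filter (¬ m ≤ ·)).card ≤ m := by
        have := Finset.card_le_card (fun i hi => (hlow i hi).2)
        rwa [Finset.card_range] at this
      have h2 : ((s.filter (¬ m ≤ ·)).card : ℝ) ≤ m + 1 := by
        have : ((s.filter (¬ m ≤ ·)).card : ℝ) ≤ m := by exact_mod_cast h1
        linarith
      calc _ ≤ ((m : ℝ) + 1) * (ε / (m + 1)) := mul_le_mul_of_nonneg_right h2 hδ.le
        _ = ε := by field_simp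
    have hR : ‖∑ i ∈ s.filter (¬ m ≤ ·), ∑ j ∈ s, W i j * Y i j‖ ≤ ε := by
      refine (norm_sum_le_of_le _ (n := fun _ => ε / (m + 1)) fun i hi => ?_).trans ?_
      · exact (hW.norm_row_le (hlow i hi).1 (Y i)).trans (hr i (hlow i hi).2 s)
      · simpa using hcard
    have hC : ‖∑ j ∈ s.filter (¬ m ≤ ·), ∑ i ∈ t, W i j * Y i j‖ ≤ ε := by
      refine (norm_sum_le_of_le _ (n := fun _ => ε / (m + 1)) fun j hj => ?_).trans ?_
      · have h1 := hW.norm_col_le (hlow j hj).1 fun i => if i ∈ t then Y i j else 0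
        rw [l2_indicator hts] at h1
        refine le_of_eq_of_le (congrArg norm ?_) (h1.trans (hc j (hlow j hj).2 t))
        simp only [mul_ite, mul_zero, ← Finset.sum_filter]
        refine Finset.sum_congr ?_ fun _ _ => rfl
        ext i
        simp only [ht, Finset.mem_filter]
        tauto
      · simpa using hcard
    have hsplit : pair s W Y = pair t W Y + ∑ j ∈ s.filter (¬ m ≤ ·), ∑ i ∈ t, W i j * Y i j
        + ∑ i ∈ s.filter (¬ m ≤ ·), ∑ j ∈ s, W i j * Y i j := by
      unfold pair
      rw [← Finset.sum_filter_add_sum_filter_not s (m ≤ ·) fun i => ∑ j ∈ s, W i j * Y i j,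
        Finset.sum_comm (s := s.filter (¬ m ≤ ·)) (t := t), ← Finset.sum_add_distrib]
      congr 1
      exact Finset.sum_congr rfl fun i _ => (Finset.sum_filter_add_sum_filter_not s _ _).symm
    rw [hsplit]
    refine norm_add₃_le.trans ?_
    linarith
  rw [Metric.tendsto_atTop]
  intro ε hε
  obtain ⟨N, hN⟩ := eventually_atTop.mp (hpair (ε / (8 * κ * (M + 3))) (by positivity))
  refine ⟨N, fun n hn => ?_⟩
  have h1 := schattenNorm_le_of_pair_le (T (u n)) (hN n hn)
  have h2 : κ * (4 * ((M + 3) * (ε / (8 * κ * (M + 3))))) = ε / 2 := by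
    field_simp
    norm_num
  have h3 : 0 ≤ schattenNorm E (T (u n)) := apply_nonneg E.norm _
  rw [Real.dist_eq, sub_zero, abs_of_nonneg h3]
  rw [← hκ, h2] at h1
  linarith

lemma IsSchurMultiplier.sub {S : traceClass →ₗ[ℂ] schatten E} {ψ : ℕ → ℕ → ℂ}
    (hS : IsSchurMultiplier S ψ) (hT : IsSchurMultiplier T φ) :
    IsSchurMultiplier (S - T) fun i j => ψ i j - φ i j := by
  intro x i j
  rw [LinearMap.sub_apply, Submodule.coe_sub, entry_sub]
  simp only [hS x i j, hT x i j, sub_mul]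

end SchurMultiplier

end SchurDP

theorem mainTheorem7 (E : SchurDP.SymmetricSequenceSpace) (φ ψ : ℕ → ℕ → ℂ)
    (Sφ Sψ : SchurDP.traceClass →ₗ[ℂ] SchurDP.schatten E)
    (hφ : SchurDP.IsSchurMultiplier Sφ φ) (hψ : SchurDP.IsSchurMultiplier Sψ ψ)
    (hpos : SchurDP.IsPositiveMap Sφ) (hle : SchurDP.IsPositiveMap (Sψ - Sφ))
    (hDP : SchurDP.IsDunfordPettis Sψ) :
    SchurDP.IsDunfordPettis Sφ := by
  open scoped ComplexOrder in
  have hKφ := hpos.isPosSemidefKernel hφ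
  have hKle := hle.isPosSemidefKernel (hψ.sub hφ)
  obtain ⟨M, hM⟩ := hDP.exists_diag_le hψ
  have hMφ : ∀ i, ‖φ i i‖ ≤ M := fun i =>
    (CStarAlgebra.norm_le_norm_of_nonneg_of_le (hKφ.diag_nonneg i)
      (sub_nonneg.mp (hKle.diag_nonneg i))).trans (hM i)
  have hrow := hDP.tendsto_row hψ
  have hcol : ∀ j, Filter.Tendsto (fun i => ψ i j) Filter.atTop (nhds 0) := fun j => by
    have h1 : ∀ i, ψ i j = star (ψ j i) := fun i => by
      have h2 := hKle.1 j i
      simp only [hKφ.1 j i, star_sub] at h2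
      exact sub_left_injective h2
    simp only [h1]
    simpa using (hrow j).star
  exact hKφ.isDunfordPettis hφ hMφ (hKφ.tendsto_row hKle hM hMφ hrow hcol)
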